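/- Let $\mathbb F$ be a field in which not every non-zero element is a root of unity (equivalently, $\mathbb F$ is not an algebraic extension of a finite field; e.g. any field of characteristic $0$). A differential calculus over an $\mathbb F$-algebra $R$ is a differential graded algebra $(\Omega R=\bigoplus_{k\ge 0}\Omega^kR,\,d)$ with $\Omega^0R=R$ and $\Omega^kR=R\,d(R)\cdots d(R)$ ($k$ factors $d(R)$) for all $k$. It is connected if $\ker(d|_R)=\mathbb F$, and $N$-dimensional if $\Omega^NR\neq 0$ and $\Omega^kR=0$ for $k>N$. A volume form is an element $\mathsf v\in\Omega^NR$ that is a free generator of $\Omega^NR$ both as a left and as a right $R$-module; let $\pi_{\mathsf v}:\Omega^NR\to R$, $\pi_{\mathsf v}(\mathsf v r)=r$. An $N$-dimensional calculus is integrable if it has a volume form $\mathsf v$ such that for every $0\le k\le N$ the map $$\ell^k_{\mathsf v}:\Omega^kR\to \mathrm{Hom}_R(\Omega^{N-k}R,R),\qquad \gamma\mapsto[\gamma'\mapsto\pi_{\mathsf v}(\gamma\gamma')],$$ into the right $R$-linear homomorphisms is bijective. The algebra $R$ is differentially smooth with respect to $\Omega R$ if $R$ is finitely generated as an algebra, its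 Gelfand–Kirillov dimension is a natural number $N$, and $(\Omega R,d)$ is connected, $N$-dimensional and integrable; $R$ is differentially smooth if it is so with respect to some differential calculus. Let $R$ be a (not necessarily commutative) $\mathbb F$-algebra that is differentially smooth with respect to a differential calculus $\Omega R$ which is finitely generated and projective as a right $R$-module. Then for all $n,m\ge 0$ the algebra $R[x_1,\ldots,x_n,y_1^{\pm1},\ldots,y_m^{\pm1}]$ of polynomials in $n$ and Laurent polynomials in $m$ commuting central variables is differentially smooth. -/

import Mathlib

universe u v w

/-- The subspace `V(n)` of an algebra spanned by `1` and all words of length at most `n` in the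
elements of the finite set `s`. -/
def wordSpan (F : Type v) {R : Type u} [Field F] [Ring R] [Algebra F R]
    (s : Finset R) (n : ℕ) : Submodule F R :=
  (1 ⊔ Submodule.span F (s : Set R)) ^ n

/-- `inf {t | dim V(n) ≤ n ^ t for n ≫ 0}`, with value `⊤` if there is no such `t`: the
Gelfand-Kirillov dimension of the affine subalgebra generated by `s`. -/
noncomputable def growthExponent (F : Type v) {R : Type u} [Field F] [Ring R] [Algebra F R]
    (s : Finset R) : EReal :=
  sInf {e : EReal | ∃ t : ℝ, e = (t : EReal) ∧
    ∀ᶠ n : ℕ in Filter.atTop, (Module.finrank F (wordSpan F s n) : ℝ) ≤ (n : ℝ) ^ t}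

/-- The Gelfand-Kirillov dimension of an algebra: the supremum of the Gelfand-Kirillov dimensions
of its affine (finitely generated) subalgebras. -/
noncomputable def GKdim (F : Type v) (R : Type u) [Field F] [Ring R] [Algebra F R] : EReal :=
  ⨆ s : Finset R, growthExponent F s

/-- A differential calculus over the `F`-algebra `R` with underlying algebra `Ω`: a differential
graded algebra `Ω = ⨁ₙ deg n` with `deg 0 = R` (identified along `ι`) satisfying the density
condition `deg n = R d(R) ⋯ d(R)` (product of subspaces, `n` factors `d(R)`). -/
structure DifferentialCalculus (F : Type v) (R : Type u) (Ω : Type w) [Field F] [Ring R]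
    [Algebra F R] [Ring Ω] [Algebra F Ω] where
  deg : ℕ → Submodule F Ω
  isInternal : DirectSum.IsInternal deg
  one_mem : (1 : Ω) ∈ deg 0
  mul_mem : ∀ {i j : ℕ} {ω η : Ω}, ω ∈ deg i → η ∈ deg j → ω * η ∈ deg (i + j)
  ι : R →ₐ[F] Ω
  ι_injective : Function.Injective ι
  range_ι : LinearMap.range ι.toLinearMap = deg 0
  d : Ω →ₗ[F] Ω
  d_mem : ∀ {n : ℕ} {ω : Ω}, ω ∈ deg n → d ω ∈ deg (n + 1)
  d_d : ∀ ω : Ω, d (d ω) = 0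
  leibniz : ∀ {n : ℕ} {ω : Ω} (η : Ω), ω ∈ deg n → d (ω * η) = d ω * η + (-1) ^ n * (ω * d η)
  density : ∀ n : ℕ, deg n =
    LinearMap.range ι.toLinearMap * (LinearMap.range (d ∘ₗ ι.toLinearMap)) ^ n

namespace DifferentialCalculus

variable {F : Type v} {R : Type u} {Ω : Type w} [Field F] [Ring R] [Algebra F R] [Ring Ω]
  [Algebra F Ω] (c : DifferentialCalculus F R Ω)

/-- The additive group of all forms, carrying the right `R`-module structure `ω · r = ω * ι r`
(as a left module over the opposite ring). -/
def Forms (_c : DifferentialCalculus F R Ω) : Type w := Ω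

instance : AddCommGroup c.Forms := inferInstanceAs (AddCommGroup Ω)

instance : Module Rᵐᵒᵖ c.Forms :=
  Module.compHom Ω (c.ι.toRingHom.op : Rᵐᵒᵖ →+* Ωᵐᵒᵖ)

/-- A form, as an element of the graded algebra. -/
def toAlg (ω : c.Forms) : Ω := ω

theorem toAlg_op_smul (r : R) (ω : c.Forms) :
    c.toAlg (MulOpposite.op r • ω) = c.toAlg ω * c.ι r := rfl

theorem ι_mem (r : R) : c.ι r ∈ c.deg 0 := by
  rw [← c.range_ι]
  exact ⟨r, rfl⟩

/-- The right `R`-module of `n`-forms. -/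
def form (n : ℕ) : Submodule Rᵐᵒᵖ c.Forms where
  carrier := {ω | c.toAlg ω ∈ c.deg n}
  add_mem' := fun {a b} ha hb => (c.deg n).add_mem (x := c.toAlg a) (y := c.toAlg b) ha hb
  zero_mem' := (c.deg n).zero_mem
  smul_mem' := fun r {ω} hω => c.mul_mem (i := n) (j := 0) (ω := c.toAlg ω) hω (c.ι_mem r.unop)

/-- `ker (d|_R) = F`. -/
def IsConnected : Prop :=
  ∀ r : R, c.d (c.ι r) = 0 ↔ ∃ a : F, r = algebraMap F R a

def HasDimension (N : ℕ) : Prop :=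
  c.deg N ≠ ⊥ ∧ ∀ n : ℕ, N < n → c.deg n = ⊥

/-- `v` is an `N`-form which is a free generator of the `N`-forms both as a right and as a left
`R`-module. -/
structure IsVolumeForm (N : ℕ) (v : Ω) : Prop where
  mem : v ∈ c.deg N
  right_free : ∀ ω ∈ c.deg N, ∃! r : R, v * c.ι r = ω
  left_free : ∀ ω ∈ c.deg N, ∃! r : R, c.ι r * v = ω

/-- The right `R`-linear map `r ↦ v r` from `R` to the `N`-forms. -/
def volumeMap {N : ℕ} {v : Ω} (hv : v ∈ c.deg N) : R →ₗ[Rᵐᵒᵖ] c.form N where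
  toFun r := ⟨(v * c.ι r : Ω), c.mul_mem (i := N) (j := 0) hv (c.ι_mem r)⟩
  map_add' r s := Subtype.ext (show v * c.ι (r + s) = v * c.ι r + v * c.ι s by
    rw [map_add, mul_add])
  map_smul' s r := Subtype.ext (show v * c.ι (r * s.unop) = v * c.ι r * c.ι s.unop by
    rw [map_mul, mul_assoc])

theorem volumeMap_bijective {N : ℕ} {v : Ω} (hv : c.IsVolumeForm N v) :
    Function.Bijective (c.volumeMap hv.mem) := by
  constructor
  · intro r s h
    obtain ⟨t, -, ht⟩ := hv.right_free (v * c.ι s) (c.volumeMap hv.mem s).2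
    rw [ht s rfl]
    exact ht r (congrArg Subtype.val h)
  · rintro ⟨ω, hω⟩
    obtain ⟨r, hr, -⟩ := hv.right_free ω hω
    exact ⟨r, Subtype.ext hr⟩

/-- The co-ordinate isomorphism `π_v`, determined by `π_v (v r) = r`. -/
noncomputable def coordinate {N : ℕ} {v : Ω} (hv : c.IsVolumeForm N v) :
    c.form N ≃ₗ[Rᵐᵒᵖ] R :=
  (LinearEquiv.ofBijective (c.volumeMap hv.mem) (c.volumeMap_bijective hv)).symm

/-- Left multiplication by the `k`-form `γ`, as a right `R`-linear map from `l`-forms to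
`N`-forms, where `k + l = N`. -/
def mulLeft {k l N : ℕ} (h : k + l = N) (γ : c.form k) : c.form l →ₗ[Rᵐᵒᵖ] c.form N where
  toFun η := ⟨(c.toAlg γ.1 * c.toAlg η.1 : Ω), by
    subst h
    exact c.mul_mem (ω := c.toAlg γ.1) (η := c.toAlg η.1) γ.2 η.2⟩
  map_add' a b := Subtype.ext (mul_add (c.toAlg γ.1) (c.toAlg a.1) (c.toAlg b.1))
  map_smul' s a := Subtype.ext (mul_assoc (c.toAlg γ.1) (c.toAlg a.1) (c.ι s.unop)).symm

/-- The map `ℓ^k_v : Ω^k R → Hom_R (Ω^l R, R)`, `γ ↦ [η ↦ π_v (γ η)]`, where `l = N - k` and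
`Hom_R` denotes homomorphisms of right `R`-modules. -/
noncomputable def ell {k l N : ℕ} {v : Ω} (hv : c.IsVolumeForm N v) (h : k + l = N)
    (γ : c.form k) : c.form l →ₗ[Rᵐᵒᵖ] R :=
  (c.coordinate hv).toLinearMap ∘ₗ c.mulLeft h γ

/-- The `N`-dimensional calculus has a volume form `v` for which all `ℓ^k_v`, `0 ≤ k ≤ N`, are
invertible. -/
def IsIntegrable (N : ℕ) : Prop :=
  ∃ (v : Ω) (hv : c.IsVolumeForm N v),
    ∀ (k l : ℕ) (h : k + l = N), Function.Bijective (c.ell hv h : c.form k → _)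

/-- The algebra `R` is differentially smooth with respect to the calculus `c`: it is affine, its
Gelfand-Kirillov dimension is a natural number `N`, and `c` is connected, `N`-dimensional and
integrable. -/
def IsSmooth : Prop :=
  Algebra.FiniteType F R ∧
    ∃ N : ℕ, GKdim F R = ((N : ℝ) : EReal) ∧ c.IsConnected ∧ c.HasDimension N ∧ c.IsIntegrable N

end DifferentialCalculus

/-- Differential smoothness. As `Ω` is spanned by the products `r₀ d(r₁) ⋯ d(rₙ)`, every calculus
over `R` is isomorphic to one in the universe of `R`. -/
def DifferentiallySmooth (F : Type v) (R : Type u) [Field F] [Ring R] [Algebra F R] : Prop :=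
  ∃ (Ω : Type u) (_ : Ring Ω) (_ : Algebra F Ω) (c : DifferentialCalculus F R Ω), c.IsSmooth

/-- The algebra `R[x₁, …, xₙ, y₁^{±1}, …, yₘ^{±1}]` of polynomials in `n` and Laurent polynomials
in `m` central variables: the monoid algebra of the monoid of monomials, with exponents in `ℕ` for
the `xᵢ` and in `ℤ` for the `yⱼ`. -/
abbrev PolynomialLaurent (R : Type u) [Ring R] (n m : ℕ) : Type u :=
  AddMonoidAlgebra R ((Fin n →₀ ℕ) × (Fin m →₀ ℤ))

/-!
A calculus over `R` is extended by one central variable at a time. Let `M` be `ℕ` or `ℤ`, so that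
`R[M]` is `R[x]` or `R[x, x⁻¹]`, and let `q` be a non-zero scalar that is not a root of unity. The
forms over `R[M]` are the algebra `Ω[M] ⊕ Ω[M] dx`, in which `x` commutes with `Ω`, `dx` commutes
with `Ω` up to the usual sign, `(dx)² = 0`, and `dx · x = q x dx`. The differential extends that of
`Ω` and satisfies `d(xᵐ) = [m] xᵐ⁻¹ dx` with `[m] = (q ^ m - 1) / (q - 1)`. These `q`-integers
vanish only for `m = 0`; this keeps the calculus connected in every characteristic, where the
choice `q = 1` would fail in characteristic `p` because `d(xᵖ) = 0`.

Integrability does not depend on the volume form chosen: it says that right `R`-linear maps from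
`l`-forms to forms of top degree `N` are left multiplications by unique `k`-forms, whenever
`k + l = N` (`bijective_ell_iff`, `IsDualPairing`). This passes from `Ω` to `Ω[M]` one coefficient
at a time, finite generation of `Ω` ensuring that only finitely many coefficients are non-zero
(`isDualPairing_polyDeg`), and from `Ω[M]` to `Ω[M] ⊕ Ω[M] dx` because the pairing of
`a + b dx` with `η₁ + η₂ dx` is `(a η₂ ± b σ(η₁)) dx`, where `σ` scales `xᵐ` by `qᵐ`, a sum of
two pairings of the former kind (`isDualPairing_polyExt`). If `v` is a volume form of `R`, then
`v dx` is one of `R[M]`.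

The Gelfand–Kirillov dimension grows by exactly one (`ExponentMonoid.GKdim_addMonoidAlgebra`): words
of length `n` have coefficients in words of length `n` over `R` and exponents of size `O(n)`, and
conversely `V(n) ⊕ V(n) x ⊕ ⋯ ⊕ V(n) xⁿ` consists of words of length `2 n`. The extended calculus is
again finitely generated on the right, so the step can be iterated.
-/

/-! ### Integrability as a duality of forms -/

/-- `Z`-valued right `S`-linear functions on `Y` are uniquely represented by left multiplication
by elements of `X`; here `S`, `X`, `Y`, `Z` are subsets of one ring `A`. A function on `Y` is
encoded by a function on `A` of which only the values on `Y` matter. -/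
structure IsDualPairing {A : Type*} [Ring A] (S X Y Z : Set A) : Prop where
  separating : ∀ γ ∈ X, (∀ η ∈ Y, γ * η = 0) → γ = 0
  represents : ∀ φ : A → A, Set.MapsTo φ Y Z → (∀ η ∈ Y, ∀ η' ∈ Y, φ (η + η') = φ η + φ η') →
    (∀ η ∈ Y, ∀ s ∈ S, φ (η * s) = φ η * s) → ∃ γ ∈ X, ∀ η ∈ Y, γ * η = φ η

namespace DifferentialCalculus

variable {F : Type v} {R : Type u} {Ω : Type w} [Field F] [Ring R] [Algebra F R] [Ring Ω]
  [Algebra F Ω] (c : DifferentialCalculus F R Ω)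

theorem mem_deg_zero {ω : Ω} : ω ∈ c.deg 0 ↔ ∃ r, c.ι r = ω := by
  rw [← c.range_ι]; rfl

theorem mul_ι_mem {n : ℕ} {ω : Ω} (hω : ω ∈ c.deg n) (r : R) : ω * c.ι r ∈ c.deg n :=
  c.mul_mem (j := 0) hω (c.ι_mem r)

theorem ell_eq_iff {k l N : ℕ} {v : Ω} (hv : c.IsVolumeForm N v) (h : k + l = N)
    (γ : c.form k) (f : c.form l →ₗ[Rᵐᵒᵖ] R) :
    c.ell hv h γ = f ↔ ∀ η : c.form l, c.toAlg γ.1 * c.toAlg η.1 = v * c.ι (f η) := by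
  rw [LinearMap.ext_iff]
  refine forall_congr' fun η => ?_
  have h1 : c.ell hv h γ η = (c.coordinate hv) (c.mulLeft h γ η) := rfl
  rw [h1, coordinate, LinearEquiv.symm_apply_eq, Subtype.ext_iff]
  rfl

/-- Since `π_v` identifies the `N`-forms with `R`, bijectivity of the maps `ℓ^k_v` does not depend
on the volume form and can be tested on `Ω^N`-valued homomorphisms. -/
theorem bijective_ell_iff {k l N : ℕ} {v : Ω} (hv : c.IsVolumeForm N v) (h : k + l = N) :
    Function.Bijective (c.ell hv h : c.form k → _) ↔
      IsDualPairing (c.deg 0 : Set Ω) (c.deg k) (c.deg l) (c.deg N) := by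
  have inj : Function.Injective fun r => v * c.ι r := fun r s hrs =>
    (hv.right_free _ (c.mul_ι_mem hv.mem s)).unique hrs rfl
  constructor
  · rintro ⟨h1, h2⟩
    refine ⟨fun γ hγ h0 => ?_, fun φ hφ hadd hmul => ?_⟩
    · have : (⟨γ, hγ⟩ : c.form k) = 0 := by
        apply h1
        rw [ell_eq_iff]
        intro η
        have e : c.ell hv h 0 η = 0 := by
          have := (c.ell_eq_iff hv h 0 0).2 (fun η => by
            change (0 : Ω) * _ = v * c.ι 0
            rw [map_zero, mul_zero, zero_mul])
          rw [this]; rfl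
        rw [e, map_zero, mul_zero]
        exact h0 _ η.2
      exact congrArg Subtype.val this
    · choose f hf using fun η : c.form l => (hv.right_free (φ (c.toAlg η.1)) (hφ η.2)).exists
      let f' : c.form l →ₗ[Rᵐᵒᵖ] R :=
        { toFun := f
          map_add' := fun a b => inj (by
            change v * c.ι _ = v * c.ι _
            rw [hf, map_add, mul_add, hf, hf]
            exact hadd _ a.2 _ b.2)
          map_smul' := fun s a => inj (by
            change v * c.ι _ = v * c.ι (f a * s.unop)
            rw [hf, map_mul, ← mul_assoc, hf]
            exact hmul _ a.2 _ (c.ι_mem _)) }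
      obtain ⟨γ, hγ⟩ := h2 f'
      rw [ell_eq_iff] at hγ
      exact ⟨c.toAlg γ.1, γ.2, fun η hη => (hγ ⟨η, hη⟩).trans (hf ⟨η, hη⟩)⟩
  · rintro ⟨h1, h2⟩
    constructor
    · intro γ γ' e
      have e1 := (c.ell_eq_iff hv h γ _).1 e
      have e2 := (c.ell_eq_iff hv h γ' _).1 rfl
      apply Subtype.ext
      refine sub_eq_zero.1 (h1 (c.toAlg γ.1 - c.toAlg γ'.1) ((c.deg k).sub_mem γ.2 γ'.2) ?_)
      intro η hη
      rw [sub_mul, sub_eq_zero]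
      exact (e1 ⟨η, hη⟩).trans (e2 ⟨η, hη⟩).symm
    · intro f
      classical
      obtain ⟨γ, hγ, hγ'⟩ := h2
        (fun η => if hη : η ∈ c.deg l then v * c.ι (f ⟨η, hη⟩) else 0)
        (fun η hη => by
          have hη' : η ∈ c.deg l := hη
          simp only [hη', dif_pos]
          exact c.mul_ι_mem hv.mem _)
        (fun a ha b hb => by
          have ha' : a ∈ c.deg l := ha
          have hb' : b ∈ c.deg l := hb
          simp only [ha', hb', add_mem ha' hb', dif_pos]
          rw [← mul_add, ← map_add, ← map_add]
          rfl)
        (fun a ha s hs => by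
          obtain ⟨r, rfl⟩ := c.mem_deg_zero.1 hs
          have ha' : a ∈ c.deg l := ha
          simp only [ha', c.mul_ι_mem ha' r, dif_pos]
          rw [mul_assoc, ← map_mul]
          have := f.map_smul (MulOpposite.op r) ⟨a, ha⟩
          exact congrArg (fun x => v * c.ι x) this)
      refine ⟨⟨γ, hγ⟩, ?_⟩
      rw [ell_eq_iff]
      rintro ⟨η, hη⟩
      exact (hγ' η hη).trans (dif_pos hη)

theorem isIntegrable_iff (N : ℕ) :
    c.IsIntegrable N ↔ ∃ v, c.IsVolumeForm N v ∧ ∀ k l, k + l = N →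
      IsDualPairing (c.deg 0 : Set Ω) (c.deg k) (c.deg l) (c.deg N) := by
  constructor
  · rintro ⟨v, hv, h⟩
    exact ⟨v, hv, fun k l hkl => (c.bijective_ell_iff hv hkl).1 (h k l hkl)⟩
  · rintro ⟨v, hv, h⟩
    exact ⟨v, hv, fun k l hkl => (c.bijective_ell_iff hv hkl).2 (h k l hkl)⟩

/-! ### Finite generation -/

/-- Finite generation of the right `R`-module of forms, expressed in the algebra `Ω` without the
action of the opposite ring. -/
theorem finite_forms_iff :
    Module.Finite Rᵐᵒᵖ c.Forms ↔ ∃ s : Finset Ω, ∀ P : AddSubgroup Ω, (s : Set Ω) ⊆ P →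
      (∀ ω ∈ P, ∀ r, ω * c.ι r ∈ P) → P = ⊤ := by
  constructor
  · rintro ⟨s, hs⟩
    refine ⟨s, fun P h1 h2 => ?_⟩
    let Q : Submodule Rᵐᵒᵖ c.Forms :=
      { carrier := {ω | c.toAlg ω ∈ P}
        add_mem' := fun {a b} ha hb => P.add_mem (x := c.toAlg a) (y := c.toAlg b) ha hb
        zero_mem' := P.zero_mem
        smul_mem' := fun r {ω} hω => h2 _ hω r.unop }
    have hQ : Q = ⊤ := by rw [eq_top_iff, ← hs]; exact Submodule.span_le.2 h1
    rw [eq_top_iff]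
    intro x _
    have hx : (show c.Forms from x) ∈ Q := by rw [hQ]; exact Submodule.mem_top
    exact hx
  · rintro ⟨s, hs⟩
    refine ⟨s, ?_⟩
    let s' : Set c.Forms := (s : Set Ω)
    let Q : Submodule Rᵐᵒᵖ c.Forms := Submodule.span Rᵐᵒᵖ s'
    let P : AddSubgroup Ω := Q.toAddSubgroup
    have hP : P = ⊤ := hs P (Submodule.subset_span (R := Rᵐᵒᵖ) (M := c.Forms) (s := s'))
      (fun ω hω r => Q.smul_mem (MulOpposite.op r) hω)
    rw [eq_top_iff]
    intro x _
    have hx : c.toAlg x ∈ P := by rw [hP]; exact AddSubgroup.mem_top _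
    exact hx

/-! ### Transport along an isomorphism of algebras -/

/-- A calculus over `R`, regarded as one over an isomorphic algebra. -/
def transport {R' : Type*} [Ring R'] [Algebra F R'] (e : R ≃ₐ[F] R') :
    DifferentialCalculus F R' Ω :=
  have hr : LinearMap.range (c.ι.comp e.symm.toAlgHom).toLinearMap =
      LinearMap.range c.ι.toLinearMap :=
    LinearMap.range_comp_of_range_eq_top c.ι.toLinearMap
      (LinearEquiv.range e.symm.toLinearEquiv)
  have hd : LinearMap.range (c.d ∘ₗ (c.ι.comp e.symm.toAlgHom).toLinearMap) =
      LinearMap.range (c.d ∘ₗ c.ι.toLinearMap) :=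
    LinearMap.range_comp_of_range_eq_top (c.d ∘ₗ c.ι.toLinearMap)
      (LinearEquiv.range e.symm.toLinearEquiv)
  { deg := c.deg
    isInternal := c.isInternal
    one_mem := c.one_mem
    mul_mem := c.mul_mem
    ι := c.ι.comp e.symm.toAlgHom
    ι_injective := c.ι_injective.comp e.symm.injective
    range_ι := hr.trans c.range_ι
    d := c.d
    d_mem := c.d_mem
    d_d := c.d_d
    leibniz := c.leibniz
    density := fun n => by rw [hr, hd]; exact c.density n }

end DifferentialCalculus

/-! ### Gelfand–Kirillov dimension of isomorphic algebras -/

section GKTransport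

variable {F : Type v} {R : Type u} {R' : Type w} [Field F] [Ring R] [Algebra F R] [Ring R']
  [Algebra F R']

theorem map_wordSpan [DecidableEq R'] (f : R →ₐ[F] R') (s : Finset R) (n : ℕ) :
    (wordSpan F s n).map f.toLinearMap = wordSpan F (s.image f) n := by
  rw [wordSpan, wordSpan, Submodule.map_pow, Submodule.map_sup, Submodule.map_one,
    Submodule.map_span, Finset.coe_image]
  rfl

theorem growthExponent_image [DecidableEq R'] (f : R →ₐ[F] R') (hf : Function.Injective f)
    (s : Finset R) :
    growthExponent F (s.image f) = growthExponent F s := by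
  unfold growthExponent
  have h n : Module.finrank F (wordSpan F (s.image f) n) = Module.finrank F (wordSpan F s n) := by
    rw [← map_wordSpan]
    exact (LinearEquiv.finrank_eq (Submodule.equivMapOfInjective f.toLinearMap hf _)).symm
  simp_rw [h]

theorem GKdim_le_of_injective (f : R →ₐ[F] R') (hf : Function.Injective f) :
    GKdim F R ≤ GKdim F R' := by
  classical
  refine iSup_le fun s => ?_
  rw [← growthExponent_image f hf s]
  exact le_iSup (fun s : Finset R' => growthExponent F s) _

theorem GKdim_congr (e : R ≃ₐ[F] R') : GKdim F R = GKdim F R' :=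
  le_antisymm (GKdim_le_of_injective e.toAlgHom e.injective)
    (GKdim_le_of_injective e.symm.toAlgHom e.symm.injective)

end GKTransport

namespace DifferentialCalculus

variable {F : Type v} {R : Type u} {Ω : Type w} [Field F] [Ring R] [Algebra F R] [Ring Ω]
  [Algebra F Ω] (c : DifferentialCalculus F R Ω)

theorem transport_isVolumeForm {R' : Type*} [Ring R'] [Algebra F R'] (e : R ≃ₐ[F] R') {N : ℕ}
    {ω : Ω} (h : c.IsVolumeForm N ω) : (c.transport e).IsVolumeForm N ω where
  mem := h.mem
  right_free η hη := by
    obtain ⟨r, hr, hu⟩ := h.right_free η hη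
    refine ⟨e r, ?_, fun s hs => e.symm_apply_eq.1 (hu _ hs)⟩
    change ω * c.ι (e.symm (e r)) = η
    rw [e.symm_apply_apply, hr]
  left_free η hη := by
    obtain ⟨r, hr, hu⟩ := h.left_free η hη
    refine ⟨e r, ?_, fun s hs => e.symm_apply_eq.1 (hu _ hs)⟩
    change c.ι (e.symm (e r)) * ω = η
    rw [e.symm_apply_apply, hr]

theorem IsSmooth.transport {c : DifferentialCalculus F R Ω} (hc : c.IsSmooth) {R' : Type*}
    [Ring R'] [Algebra F R'] (e : R ≃ₐ[F] R') : (c.transport e).IsSmooth := by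
  obtain ⟨hft, N, hGK, hconn, hdim, hint⟩ := hc
  refine ⟨hft.equiv e, N, (GKdim_congr e).symm.trans hGK, fun r => ?_, hdim, ?_⟩
  · refine (hconn (e.symm r)).trans (exists_congr fun a => ?_)
    rw [e.symm_apply_eq, e.commutes]
  · rw [isIntegrable_iff] at hint ⊢
    obtain ⟨ω, hω, h⟩ := hint
    exact ⟨ω, c.transport_isVolumeForm e hω, h⟩

theorem finite_forms_transport (h : Module.Finite Rᵐᵒᵖ c.Forms) {R' : Type*}
    [Ring R'] [Algebra F R'] (e : R ≃ₐ[F] R') : Module.Finite R'ᵐᵒᵖ (c.transport e).Forms := by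
  rw [finite_forms_iff] at h ⊢
  obtain ⟨s, hs⟩ := h
  refine ⟨s, fun P h1 h2 => hs P h1 fun ω hω r => ?_⟩
  have := h2 ω hω (e r)
  change ω * c.ι (e.symm (e r)) ∈ P at this
  rwa [e.symm_apply_apply] at this

/-! ### Homogeneous components and the parity automorphism -/

theorem homogeneous_induction {p : Ω → Prop} (zero : p 0) (add : ∀ ω η, p ω → p η → p (ω + η))
    (mem : ∀ n, ∀ ω ∈ c.deg n, p ω) (ω : Ω) : p ω :=
  Submodule.iSup_induction c.deg (motive := p)
    (c.isInternal.submodule_iSup_eq_top ▸ Submodule.mem_top) mem zero add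

/-- The linear map acting on `n`-forms as multiplication by the scalar `a n`. -/
noncomputable def degreeScale (a : ℕ → F) : Ω →ₗ[F] Ω :=
  DirectSum.toModule F ℕ Ω (fun n => a n • (c.deg n).subtype) ∘ₗ
    (LinearEquiv.ofBijective (DirectSum.coeLinearMap c.deg) c.isInternal).symm.toLinearMap

theorem degreeScale_apply (a : ℕ → F) {n : ℕ} {ω : Ω} (h : ω ∈ c.deg n) :
    c.degreeScale a ω = a n • ω := by
  have : (LinearEquiv.ofBijective (DirectSum.coeLinearMap c.deg) c.isInternal).symm ω =
      DirectSum.lof F ℕ (fun n => c.deg n) n ⟨ω, h⟩ := by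
    rw [LinearEquiv.symm_apply_eq]
    exact (DirectSum.coeLinearMap_lof c.deg n ⟨ω, h⟩).symm
  simp [degreeScale, this, DirectSum.toModule_lof]

/-- The projection onto the `n`-forms. -/
noncomputable def proj (n : ℕ) : Ω →ₗ[F] Ω := c.degreeScale (Pi.single n 1)

theorem proj_of_mem {n : ℕ} {ω : Ω} (h : ω ∈ c.deg n) : c.proj n ω = ω := by
  simp [proj, c.degreeScale_apply _ h]

theorem proj_of_mem_of_ne {m n : ℕ} {ω : Ω} (h : ω ∈ c.deg m) (hmn : m ≠ n) :
    c.proj n ω = 0 := by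
  simp [proj, c.degreeScale_apply _ h, Pi.single_eq_of_ne hmn]

theorem proj_mem (n : ℕ) (ω : Ω) : c.proj n ω ∈ c.deg n := by
  induction ω using c.homogeneous_induction with
  | zero => simp
  | add ω η h1 h2 => rw [map_add]; exact add_mem h1 h2
  | mem m ω h =>
    rcases eq_or_ne m n with rfl | hmn
    · rwa [c.proj_of_mem h]
    · rw [c.proj_of_mem_of_ne h hmn]; exact zero_mem _

theorem proj_mul_ι (n : ℕ) (ω : Ω) (r : R) : c.proj n (ω * c.ι r) = c.proj n ω * c.ι r := by
  induction ω using c.homogeneous_induction with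
  | zero => simp
  | add ω η h1 h2 => rw [add_mul, map_add, h1, h2, map_add, add_mul]
  | mem m ω h =>
    rcases eq_or_ne m n with rfl | hmn
    · rw [c.proj_of_mem h, c.proj_of_mem (c.mul_ι_mem h r)]
    · rw [c.proj_of_mem_of_ne h hmn, c.proj_of_mem_of_ne (c.mul_ι_mem h r) hmn, zero_mul]

/-- The parity automorphism `ω ↦ (-1)ⁿ ω`, `ω ∈ Ωⁿ`, as an algebra endomorphism. -/
noncomputable def parity : Ω →ₐ[F] Ω :=
  AlgHom.ofLinearMap (c.degreeScale fun n => (-1) ^ n)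
    (by rw [c.degreeScale_apply _ c.one_mem]; simp)
    (fun ω η => by
      induction ω using c.homogeneous_induction with
      | zero => simp
      | add ω ω' h1 h2 => rw [add_mul, map_add, h1, h2, map_add, add_mul]
      | mem m ω hω =>
        induction η using c.homogeneous_induction with
        | zero => simp
        | add η η' h1 h2 => rw [mul_add, map_add, h1, h2, map_add, mul_add]
        | mem n η hη =>
          rw [c.degreeScale_apply _ hω, c.degreeScale_apply _ hη,
            c.degreeScale_apply _ (c.mul_mem hω hη), smul_mul_smul_comm, pow_add])

theorem parity_of_mem {n : ℕ} {ω : Ω} (h : ω ∈ c.deg n) : c.parity ω = (-1 : F) ^ n • ω :=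
  c.degreeScale_apply _ h

theorem parity_mem {n : ℕ} {ω : Ω} (h : ω ∈ c.deg n) : c.parity ω ∈ c.deg n := by
  rw [c.parity_of_mem h]
  exact Submodule.smul_mem _ _ h

theorem parity_parity (ω : Ω) : c.parity (c.parity ω) = ω := by
  induction ω using c.homogeneous_induction with
  | zero => simp
  | add ω η h1 h2 => rw [map_add, map_add, h1, h2]
  | mem n ω h =>
    rw [c.parity_of_mem h, map_smul, c.parity_of_mem h, smul_smul, ← mul_pow]
    simp

theorem parity_d (ω : Ω) : c.parity (c.d ω) = -c.d (c.parity ω) := by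
  induction ω using c.homogeneous_induction with
  | zero => simp
  | add ω η h1 h2 => rw [map_add, map_add, h1, h2, map_add, map_add, neg_add]
  | mem n ω h =>
    rw [c.parity_of_mem h, c.parity_of_mem (c.d_mem h), map_smul, pow_succ]
    simp

theorem d_mul (ω η : Ω) : c.d (ω * η) = c.d ω * η + c.parity ω * c.d η := by
  induction ω using c.homogeneous_induction with
  | zero => simp
  | add ω ω' h1 h2 => rw [add_mul, map_add, h1, h2, map_add, map_add, add_mul, add_mul]; abel
  | mem n ω h =>
    rw [c.leibniz η h, c.parity_of_mem h, smul_mul_assoc]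
    congr 1
    rcases Nat.even_or_odd n with hn | hn <;> simp [hn.neg_one_pow]

theorem d_one : c.d 1 = 0 := by
  have := c.d_mul 1 1
  simpa using this

end DifferentialCalculus

/-- `R` is differentially smooth with respect to a calculus which is a finitely generated right
`R`-module. -/
def HasFiniteSmoothCalculus (F : Type v) (R : Type u) [Field F] [Ring R] [Algebra F R] : Prop :=
  ∃ (Ω : Type u) (_ : Ring Ω) (_ : Algebra F Ω) (c : DifferentialCalculus F R Ω),
    c.IsSmooth ∧ Module.Finite Rᵐᵒᵖ c.Forms

theorem HasFiniteSmoothCalculus.of_algEquiv {F : Type v} {R R' : Type u} [Field F] [Ring R]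
    [Algebra F R] [Ring R'] [Algebra F R'] (e : R ≃ₐ[F] R') (h : HasFiniteSmoothCalculus F R) :
    HasFiniteSmoothCalculus F R' := by
  obtain ⟨Ω, _, _, c, hc, hf⟩ := h
  exact ⟨Ω, _, _, c.transport e, hc.transport e, c.finite_forms_transport hf e⟩

/-! ### Exponent monoids of rank one -/

/-- A monoid of exponents of a single variable `x`: a submonoid of `ℤ` (embedded by `toInt`)
which contains the exponent `1` (named `gen`) and, with every non-zero `m`, also `m - 1`
(named `pred m`; the value `pred 0` is irrelevant). The examples are `ℕ` and `ℤ`. -/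
structure ExponentMonoid (M : Type*) [AddCommMonoid M] where
  toInt : M →+ ℤ
  toInt_injective : Function.Injective toInt
  gen : M
  toInt_gen : toInt gen = 1
  pred : M → M
  pred_add_gen : ∀ m, m ≠ 0 → pred m + gen = m

namespace ExponentMonoid

/-- The exponents of a polynomial variable. -/
def nat : ExponentMonoid ℕ where
  toInt := Nat.castAddMonoidHom ℤ
  toInt_injective := Nat.cast_injective
  gen := 1
  toInt_gen := rfl
  pred n := n - 1
  pred_add_gen m hm := by omega

/-- The exponents of an invertible variable. -/
def int : ExponentMonoid ℤ where
  toInt := AddMonoidHom.id ℤ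
  toInt_injective := Function.injective_id
  gen := 1
  toInt_gen := rfl
  pred n := n - 1
  pred_add_gen m _ := by omega

variable {M : Type*} [AddCommMonoid M] (X : ExponentMonoid M) {F : Type*} [Field F]

theorem toInt_ne_zero {m : M} (h : m ≠ 0) : X.toInt m ≠ 0 := fun h0 =>
  h (X.toInt_injective (h0.trans X.toInt.map_zero.symm))

theorem gen_ne_zero : X.gen ≠ 0 := fun h => by
  have := X.toInt_gen
  simp [h] at this

theorem toInt_pred {m : M} (h : m ≠ 0) : X.toInt (X.pred m) = X.toInt m - 1 := by
  have := congrArg X.toInt (X.pred_add_gen m h)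
  rw [map_add, X.toInt_gen] at this
  omega

theorem pred_gen : X.pred X.gen = 0 := X.toInt_injective <| by
  rw [X.toInt_pred X.gen_ne_zero, X.toInt_gen]; simp

/-- The `q`-integer `[m] = (q ^ m - 1) / (q - 1)`. -/
noncomputable def qInt (q : Fˣ) (m : M) : F :=
  (((q ^ X.toInt m : Fˣ) : F) - 1) / ((q : F) - 1)

variable {q : Fˣ}

theorem qInt_zero : X.qInt q 0 = 0 := by simp [qInt]

theorem qInt_gen (hq : q ≠ 1) : X.qInt q X.gen = 1 := by
  rw [qInt, X.toInt_gen, zpow_one, div_self]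
  rw [sub_ne_zero]
  exact fun h => hq (Units.ext h)

theorem qInt_ne_zero (hq : ¬ IsOfFinOrder q) {m : M} (hm : m ≠ 0) : X.qInt q m ≠ 0 := by
  have h1 (n : ℤ) (hn : n ≠ 0) : ((q ^ n : Fˣ) : F) - 1 ≠ 0 := by
    rw [sub_ne_zero]
    intro h
    exact hq (isOfFinOrder_iff_zpow_eq_one.2 ⟨n, hn, Units.ext h⟩)
  exact div_ne_zero (h1 _ (X.toInt_ne_zero hm)) (by simpa using h1 1 one_ne_zero)

theorem qInt_add (m n : M) :
    X.qInt q (m + n) = X.qInt q m * ((q ^ X.toInt n : Fˣ) : F) + X.qInt q n := by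
  rw [qInt, qInt, qInt, map_add, zpow_add, Units.val_mul, div_mul_eq_mul_div, ← add_div]
  ring

end ExponentMonoid

/-! ### Coefficientwise constructions -/

namespace AddMonoidAlgebra

variable {F : Type v} {A : Type u} {M : Type*} [Field F] [Ring A] [Algebra F A]

/-- The coefficientwise extension of a linear endomorphism of `A` to `A[M]`. -/
noncomputable def coeffwise (f : A →ₗ[F] A) : AddMonoidAlgebra A M →ₗ[F] AddMonoidAlgebra A M :=
  (coeffLinearEquiv F).symm.toLinearMap ∘ₗ Finsupp.mapRange.linearMap f ∘ₗ
    (coeffLinearEquiv F).toLinearMap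

@[simp] theorem coeff_coeffwise (f : A →ₗ[F] A) (b : AddMonoidAlgebra A M) (m : M) :
    (coeffwise f b).coeff m = f (b.coeff m) := rfl

@[simp] theorem coeffwise_single (f : A →ₗ[F] A) (m : M) (a : A) :
    coeffwise f (single m a : AddMonoidAlgebra A M) = single m (f a) := by
  classical
  ext n
  rw [coeff_coeffwise, coeff_single, coeff_single, Finsupp.single_apply, Finsupp.single_apply]
  split_ifs <;> simp

/-- The elements of `A[M]` with all coefficients in a subspace `W` of `A`. -/
def withCoeffs (W : Submodule F A) : Submodule F (AddMonoidAlgebra A M) where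
  carrier := {b | ∀ m, b.coeff m ∈ W}
  add_mem' ha hb m := W.add_mem (ha m) (hb m)
  zero_mem' _ := W.zero_mem
  smul_mem' r _ hb m := W.smul_mem r (hb m)

theorem single_mem_withCoeffs {W : Submodule F A} {a : A} (h : a ∈ W) (m : M) :
    (single m a : AddMonoidAlgebra A M) ∈ withCoeffs W := by
  classical
  intro n
  rw [coeff_single, Finsupp.single_apply]
  split_ifs
  exacts [h, W.zero_mem]

/-- Elements with coefficients in `W` are sums of monomials with coefficients in `W`. -/
theorem withCoeffs_induction {W : Submodule F A} {p : AddMonoidAlgebra A M → Prop}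
    (zero : p 0) (add : ∀ b ∈ withCoeffs W, ∀ b' ∈ withCoeffs W, p b → p b' → p (b + b'))
    (single : ∀ m, ∀ a ∈ W, p (single m a)) {b : AddMonoidAlgebra A M} (h : b ∈ withCoeffs W) :
    p b := by
  classical
  rw [← sum_coeff_single b, Finsupp.sum]
  have : ∀ s : Finset M, p (∑ m ∈ s, AddMonoidAlgebra.single m (b.coeff m)) := fun s => by
    induction s using Finset.induction_on with
    | empty => simpa using zero
    | insert m s hm ih =>
      rw [Finset.sum_insert hm]
      exact add _ (single_mem_withCoeffs (h m) m) _
        (Submodule.sum_mem _ fun i _ => single_mem_withCoeffs (h i) i) (single _ _ (h m)) ih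
  exact this _

theorem withCoeffs_mul_mem [AddMonoid M] {U V W : Submodule F A}
    (hUV : ∀ a ∈ U, ∀ b ∈ V, a * b ∈ W)
    {x y : AddMonoidAlgebra A M} (hx : x ∈ withCoeffs U) (hy : y ∈ withCoeffs V) :
    x * y ∈ withCoeffs W := by
  refine withCoeffs_induction (p := fun x => x * y ∈ withCoeffs W) (by simp)
    (fun b _ b' _ h h' => by rw [add_mul]; exact add_mem h h') (fun m a ha => ?_) hx
  refine withCoeffs_induction (p := fun y => single m a * y ∈ withCoeffs W) (by simp)
    (fun b _ b' _ h h' => by rw [mul_add]; exact add_mem h h') (fun n b hb => ?_) hy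
  rw [single_mul_single]
  exact single_mem_withCoeffs (hUV a ha b hb) _

theorem coeffwise_mem_withCoeffs {f : A →ₗ[F] A} {U W : Submodule F A} (h : ∀ a ∈ U, f a ∈ W)
    {b : AddMonoidAlgebra A M} (hb : b ∈ withCoeffs U) : coeffwise f b ∈ withCoeffs W :=
  fun m => h _ (hb m)

theorem withCoeffs_eq_bot_iff [Nonempty M] {W : Submodule F A} :
    (withCoeffs W : Submodule F (AddMonoidAlgebra A M)) = ⊥ ↔ W = ⊥ := by
  constructor
  · intro h
    rw [Submodule.eq_bot_iff] at h ⊢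
    intro a ha
    obtain ⟨m⟩ := ‹Nonempty M›
    simpa using h _ (single_mem_withCoeffs ha m)
  · rintro rfl
    rw [Submodule.eq_bot_iff]
    intro b hb
    ext m
    simpa using hb m

end AddMonoidAlgebra

namespace DifferentialCalculus

open AddMonoidAlgebra

variable {F : Type v} {R : Type u} {Ω : Type w} [Field F] [Ring R] [Algebra F R] [Ring Ω]
  [Algebra F Ω] (c : DifferentialCalculus F R Ω)
variable {M : Type*} [AddCommMonoid M] (X : ExponentMonoid M)

/-! ### The forms with polynomial coefficients -/

/-- The `n`-forms with coefficients in the monomials of `M`, that is, `Ωⁿ[M]`. -/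
abbrev polyDeg (M : Type*) [AddCommMonoid M] (n : ℕ) : Submodule F (AddMonoidAlgebra Ω M) :=
  withCoeffs (c.deg n)

/-- The automorphism `ω xᵐ ↦ (-1)ⁿ qᵐ ω xᵐ`, `ω ∈ Ωⁿ`, as an algebra endomorphism. -/
noncomputable def twistHom (q : Fˣ) : AddMonoidAlgebra Ω M →ₐ[F] AddMonoidAlgebra Ω M :=
  AddMonoidAlgebra.liftNCAlgHom (singleZeroAlgHom.comp c.parity)
    { toFun := fun m => single m.toAdd (algebraMap F Ω ((q ^ X.toInt m.toAdd : Fˣ) : F))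
      map_one' := by simp [AddMonoidAlgebra.one_def]
      map_mul' := fun m n => by simp [zpow_add, single_mul_single] }
    (fun ω m => single_commute_single (AddCommute.all _ _) (Algebra.commutes _ _).symm)

theorem twistHom_single (q : Fˣ) (m : M) (ω : Ω) :
    c.twistHom X q (single m ω) = single m (((q ^ X.toInt m : Fˣ) : F) • c.parity ω) := by
  simp [twistHom, Algebra.smul_def, Algebra.commutes]

theorem twistHom_twistHom (q : Fˣ) (b : AddMonoidAlgebra Ω M) :
    c.twistHom X q (c.twistHom X q⁻¹ b) = b := by
  induction b using AddMonoidAlgebra.induction_linear with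
  | zero => simp
  | add x y hx hy => rw [map_add, map_add, hx, hy]
  | single m ω =>
    rw [twistHom_single, twistHom_single, map_smul, c.parity_parity, smul_smul, ← Units.val_mul,
      ← mul_zpow]
    simp

/-- The automorphism `ω xᵐ ↦ (-1)ⁿ qᵐ ω xᵐ`, `ω ∈ Ωⁿ`. -/
noncomputable def twist (q : Fˣ) : AddMonoidAlgebra Ω M ≃ₐ[F] AddMonoidAlgebra Ω M :=
  AlgEquiv.ofAlgHom (c.twistHom X q) (c.twistHom X q⁻¹)
    (AlgHom.ext fun b => c.twistHom_twistHom X q b)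
    (AlgHom.ext fun b => by simpa using c.twistHom_twistHom X q⁻¹ b)

theorem twist_single (q : Fˣ) (m : M) (ω : Ω) :
    c.twist X q (single m ω) = single m (((q ^ X.toInt m : Fˣ) : F) • c.parity ω) :=
  c.twistHom_single X q m ω

theorem twist_symm (q : Fˣ) : (c.twist X q).symm = c.twist X q⁻¹ := by
  ext b : 1
  rw [AlgEquiv.symm_apply_eq]
  exact (c.twistHom_twistHom X q b).symm

theorem coeff_twist (q : Fˣ) (b : AddMonoidAlgebra Ω M) (m : M) :
    (c.twist X q b).coeff m = ((q ^ X.toInt m : Fˣ) : F) • c.parity (b.coeff m) := by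
  classical
  induction b using AddMonoidAlgebra.induction_linear with
  | zero => simp
  | add x y hx hy => simp [hx, hy]
  | single n ω =>
    rw [twist_single, coeff_single, coeff_single, Finsupp.single_apply, Finsupp.single_apply]
    split_ifs with h
    · rw [h]
    · simp

theorem twist_mem {q : Fˣ} {n : ℕ} {b : AddMonoidAlgebra Ω M} (hb : b ∈ c.polyDeg M n) :
    c.twist X q b ∈ c.polyDeg M n := fun m => by
  rw [coeff_twist]
  exact Submodule.smul_mem _ _ (c.parity_mem (hb m))

theorem twist_symm_mem {q : Fˣ} {n : ℕ} {b : AddMonoidAlgebra Ω M}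
    (hb : b ∈ c.polyDeg M n) : (c.twist X q).symm b ∈ c.polyDeg M n := by
  rw [twist_symm]
  exact c.twist_mem X hb

/-- The `q`-derivation `ω xᵐ ↦ (-1)ⁿ [m] ω xᵐ⁻¹`, `ω ∈ Ωⁿ`, the partial derivative in direction
`x` up to a sign. -/
noncomputable def qDeriv (q : Fˣ) : AddMonoidAlgebra Ω M →ₗ[F] AddMonoidAlgebra Ω M :=
  Finsupp.lsum F (fun m => X.qInt q m • (lsingle (X.pred m) ∘ₗ c.parity.toLinearMap)) ∘ₗ
    (coeffLinearEquiv F).toLinearMap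

theorem qDeriv_single (q : Fˣ) (m : M) (ω : Ω) :
    c.qDeriv X q (single m ω) = X.qInt q m • single (X.pred m) (c.parity ω) := by
  simp [qDeriv]

theorem coeffwise_d_mul (b b' : AddMonoidAlgebra Ω M) :
    coeffwise c.d (b * b') =
      coeffwise c.d b * b' + coeffwise c.parity.toLinearMap b * coeffwise c.d b' := by
  induction b using AddMonoidAlgebra.induction_linear with
  | zero => simp
  | add x y hx hy => simp only [add_mul, map_add, hx, hy]; abel
  | single m ω =>
    induction b' using AddMonoidAlgebra.induction_linear with
    | zero => simp
    | add x y hx hy => simp only [mul_add, map_add, hx, hy]; abel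
    | single n η => simp [single_mul_single, c.d_mul]

theorem coeffwise_d_twist (q : Fˣ) (b : AddMonoidAlgebra Ω M) :
    coeffwise c.d (c.twist X q b) = -c.twist X q (coeffwise c.d b) := by
  ext m
  simp [coeff_twist, c.parity_d]

theorem qDeriv_mul (q : Fˣ) (b b' : AddMonoidAlgebra Ω M) :
    c.qDeriv X q (b * b') = c.qDeriv X q b * c.twist X q b' +
      coeffwise c.parity.toLinearMap b * c.qDeriv X q b' := by
  induction b using AddMonoidAlgebra.induction_linear with
  | zero => simp
  | add x y hx hy => simp only [add_mul, map_add, hx, hy]; abel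
  | single m ω =>
    induction b' using AddMonoidAlgebra.induction_linear with
    | zero => simp
    | add x y hx hy => simp only [mul_add, map_add, hx, hy]; abel
    | single n η =>
      rw [single_mul_single, qDeriv_single, qDeriv_single, qDeriv_single, twist_single,
        coeffwise_single, smul_mul_assoc, single_mul_single, mul_smul_comm, mul_smul_comm,
        single_mul_single, map_mul, X.qInt_add, AlgHom.toLinearMap_apply]
      rcases eq_or_ne m 0 with rfl | hm
      · simp [X.qInt_zero]
      rcases eq_or_ne n 0 with rfl | hn
      · simp [X.qInt_zero]
      -- both sides are multiples of one monomial, even if `m + n = 0`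
      have e : X.pred m + n = m + X.pred n := X.toInt_injective <| by
        rw [map_add, map_add, X.toInt_pred hm, X.toInt_pred hn]; ring
      rcases eq_or_ne (m + n) 0 with h | h
      · have h0 := X.qInt_add (q := q) m n
        rw [h, X.qInt_zero] at h0
        rw [← h0, zero_smul, e, ← smul_single, smul_smul, ← add_smul, ← h0, zero_smul]
      · have e' : X.pred (m + n) = m + X.pred n := X.toInt_injective <| by
          rw [X.toInt_pred h, map_add, map_add, X.toInt_pred hn]; ring
        rw [e, e', ← smul_single, smul_smul, ← add_smul]

theorem qDeriv_coeffwise_d (q : Fˣ) (b : AddMonoidAlgebra Ω M) :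
    c.qDeriv X q (coeffwise c.d b) = -coeffwise c.d (c.qDeriv X q b) := by
  induction b using AddMonoidAlgebra.induction_linear with
  | zero => simp
  | add x y hx hy => simp only [map_add, hx, hy]; abel
  | single m ω =>
    rw [coeffwise_single, qDeriv_single, qDeriv_single, map_smul, coeffwise_single, c.parity_d,
      ← smul_neg]
    congr 1
    ext; simp

theorem qDeriv_mem {q : Fˣ} {n : ℕ} {b : AddMonoidAlgebra Ω M} (hb : b ∈ c.polyDeg M n) :
    c.qDeriv X q b ∈ c.polyDeg M n := by
  refine withCoeffs_induction (p := fun b => c.qDeriv X q b ∈ c.polyDeg M n) (by simp)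
    (fun b _ b' _ h h' => by rw [map_add]; exact add_mem h h') (fun m ω hω => ?_) hb
  rw [qDeriv_single]
  exact Submodule.smul_mem _ _ (single_mem_withCoeffs (c.parity_mem hω) _)

/-- Multiplication by `x` turns the lowered exponents back, also in degree `0`, where the exponent
`pred 0` is meaningless but has coefficient `[0] = 0`. -/
theorem coeff_qDeriv_mul_gen (q : Fˣ) (b : AddMonoidAlgebra Ω M) (m : M) :
    (c.qDeriv X q b * single X.gen 1).coeff m = X.qInt q m • c.parity (b.coeff m) := by
  classical
  induction b using AddMonoidAlgebra.induction_linear with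
  | zero => simp
  | add x y hx hy => simp [add_mul, hx, hy]
  | single n ω =>
    rw [qDeriv_single, smul_mul_assoc, single_mul_single, mul_one, coeff_smul_apply, coeff_single,
      coeff_single, Finsupp.single_apply, Finsupp.single_apply]
    rcases eq_or_ne n 0 with rfl | hn
    · rw [X.qInt_zero, zero_smul]
      split_ifs with h
      · rw [← h, X.qInt_zero, zero_smul]
      · simp
    · rw [X.pred_add_gen n hn]
      split_ifs with h
      · rw [h]
      · simp

theorem coeff_eq_zero_of_qDeriv_eq_zero {q : Fˣ} (hq : ¬ IsOfFinOrder q)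
    {b : AddMonoidAlgebra Ω M} (h : c.qDeriv X q b = 0) {m : M} (hm : m ≠ 0) : b.coeff m = 0 := by
  have h1 := c.coeff_qDeriv_mul_gen X q b m
  rw [h, zero_mul, coeff_zero, Finsupp.zero_apply] at h1
  have h2 := (smul_eq_zero.1 h1.symm).resolve_left (X.qInt_ne_zero hq hm)
  rw [← c.parity_parity (b.coeff m), h2, map_zero]

/-- A right `R[M]`-linear map between forms with coefficients in `R[M]` is determined by its values
on forms with constant coefficients, and the coefficients of these are right `R`-linear. Finite
generation bounds the exponents that occur. -/
theorem isDualPairing_polyDeg (hfin : Module.Finite Rᵐᵒᵖ c.Forms) {k l N : ℕ}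
    (h : IsDualPairing (c.deg 0 : Set Ω) (c.deg k) (c.deg l) (c.deg N)) :
    IsDualPairing (c.polyDeg M 0 : Set (AddMonoidAlgebra Ω M)) (c.polyDeg M k) (c.polyDeg M l)
      (c.polyDeg M N) where
  separating γ hγ h0 := by
    ext m
    refine h.separating _ (hγ m) fun η hη => ?_
    have := congrArg (fun b => b.coeff m) (h0 _ (single_mem_withCoeffs hη 0))
    rwa [coeff_mul_single_zero] at this
  represents φ hφ hadd hmul := by
    classical
    have hφ0 : φ 0 = 0 := by
      have := hadd 0 (zero_mem _) 0 (zero_mem _)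
      simpa using this
    have hex (m : M) : ∃ γ ∈ c.deg k, ∀ η ∈ c.deg l, γ * η = (φ (single 0 η)).coeff m := by
      refine h.represents (fun η => (φ (single 0 η)).coeff m)
        (fun η hη => hφ (single_mem_withCoeffs hη 0) m) (fun η hη η' hη' => ?_)
        (fun η hη r hr => ?_)
      · rw [single_add, hadd _ (single_mem_withCoeffs hη 0) _ (single_mem_withCoeffs hη' 0)]
        rfl
      · have := hmul _ (single_mem_withCoeffs hη 0) _ (single_mem_withCoeffs hr 0)
        rw [single_mul_single, add_zero] at this
        rw [this, coeff_mul_single_zero]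
    choose γ hγ hγφ using hex
    obtain ⟨s, hs⟩ := c.finite_forms_iff.1 hfin
    let T : Finset M := s.biUnion fun ω => (φ (single 0 (c.proj l ω))).coeff.support
    have hT (m : M) (hm : m ∉ T) : γ m = 0 := by
      refine h.separating _ (hγ m) fun η hη => ?_
      let P : AddSubgroup Ω :=
        { carrier := {ω | γ m * c.proj l ω = 0}
          zero_mem' := by simp
          add_mem' := fun {a b} ha hb => by
            change γ m * c.proj l (a + b) = 0
            rw [map_add, mul_add, ha, hb, add_zero]
          neg_mem' := fun {a} ha => by
            change γ m * c.proj l (-a) = 0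
            rw [map_neg, mul_neg, ha, neg_zero] }
      have hP : P = ⊤ := hs P (fun ω hω => by
          change γ m * c.proj l ω = 0
          rw [hγφ m _ (c.proj_mem l ω)]
          by_contra hne
          exact hm (Finset.mem_biUnion.2 ⟨ω, hω, Finsupp.mem_support_iff.2 hne⟩))
        (fun ω hω r => by
          change γ m * c.proj l (ω * c.ι r) = 0
          rw [c.proj_mul_ι, ← mul_assoc, hω, zero_mul])
      have : η ∈ P := hP ▸ AddSubgroup.mem_top _
      have h2 : γ m * c.proj l η = 0 := this
      rwa [c.proj_of_mem hη] at h2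
    refine ⟨ofCoeff (Finsupp.onFinset T γ fun m hm => by_contra fun h' => hm (hT m h')),
      fun m => hγ m, ?_⟩
    intro η hη
    refine withCoeffs_induction (p := fun η => _ * η = φ η) (by rw [mul_zero, hφ0])
      (fun b hb b' hb' h1 h2 => by rw [mul_add, h1, h2, hadd b hb b' hb']) (fun m ω hω => ?_) hη
    have e : (single m ω : AddMonoidAlgebra Ω M) = single 0 ω * single m 1 := by
      rw [single_mul_single, zero_add, mul_one]
    rw [e, hmul _ (single_mem_withCoeffs hω 0) _ (single_mem_withCoeffs c.one_mem m), ← mul_assoc]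
    congr 1
    ext n
    rw [coeff_mul_single_zero]
    exact hγφ n ω hω

end DifferentialCalculus

/-! ### Square-zero extensions by a twisted bimodule -/

section TwistedExt

variable {F : Type v} {B : Type u} [Field F] [Ring B] [Algebra F B]

/-- The ring `B`, as a bimodule with the regular left action and the right action `m · b = m τ(b)`
twisted by an algebra endomorphism `τ`. -/
def RightTwist (_τ : B →ₐ[F] B) : Type u := B

namespace RightTwist

variable (τ : B →ₐ[F] B)

instance : AddCommGroup (RightTwist τ) := inferInstanceAs (AddCommGroup B)
instance : Module F (RightTwist τ) := inferInstanceAs (Module F B)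
instance : Module B (RightTwist τ) := inferInstanceAs (Module B B)
instance : Module Bᵐᵒᵖ (RightTwist τ) := Module.compHom B (τ.toRingHom.op : Bᵐᵒᵖ →+* Bᵐᵒᵖ)
instance : SMulCommClass B Bᵐᵒᵖ (RightTwist τ) :=
  ⟨fun a b m => (mul_assoc a (show B from m) (τ b.unop)).symm⟩
instance : IsScalarTower F B (RightTwist τ) := inferInstanceAs (IsScalarTower F B B)
instance : IsScalarTower F Bᵐᵒᵖ (RightTwist τ) :=
  ⟨fun a b m => by
    change (show B from m) * τ (a • b.unop) = a • ((show B from m) * τ b.unop)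
    rw [map_smul, mul_smul_comm]⟩

end RightTwist

/-- The algebra `B ⊕ B θ` with `θ b = τ(b) θ` and `θ² = 0`. -/
def TwistedExt (τ : B →ₐ[F] B) : Type u := TrivSqZeroExt B (RightTwist τ)

namespace TwistedExt

variable (τ : B →ₐ[F] B)

instance : Ring (TwistedExt τ) := inferInstanceAs (Ring (TrivSqZeroExt B (RightTwist τ)))
instance : Algebra F (TwistedExt τ) :=
  inferInstanceAs (Algebra F (TrivSqZeroExt B (RightTwist τ)))

/-- The element `b + m θ`, for `p = (b, m)`. -/
def mk : B × B →ₗ[F] TwistedExt τ where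
  toFun p := (p : TrivSqZeroExt B (RightTwist τ))
  map_add' _ _ := rfl
  map_smul' _ _ := rfl

/-- The component `b` of `b + m θ`. -/
def fst : TwistedExt τ →ₗ[F] B where
  toFun x := TrivSqZeroExt.fst (R := B) (M := RightTwist τ) x
  map_add' _ _ := rfl
  map_smul' _ _ := rfl

/-- The component `m` of `b + m θ`. -/
def snd : TwistedExt τ →ₗ[F] B where
  toFun x := TrivSqZeroExt.snd (R := B) (M := RightTwist τ) x
  map_add' _ _ := rfl
  map_smul' _ _ := rfl

/-- The inclusion of `B` in `B ⊕ B θ`. -/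
def inl : B →ₐ[F] TwistedExt τ := TrivSqZeroExt.inlAlgHom F B (RightTwist τ)

variable {τ}

@[simp] theorem fst_mk (p : B × B) : fst τ (mk τ p) = p.1 := rfl
@[simp] theorem snd_mk (p : B × B) : snd τ (mk τ p) = p.2 := rfl
@[simp] theorem fst_inl (b : B) : fst τ (inl τ b) = b := rfl
@[simp] theorem snd_inl (b : B) : snd τ (inl τ b) = 0 := rfl
@[simp] theorem fst_mul (x y : TwistedExt τ) : fst τ (x * y) = fst τ x * fst τ y := rfl
@[simp] theorem snd_mul (x y : TwistedExt τ) :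
    snd τ (x * y) = fst τ x * snd τ y + snd τ x * τ (fst τ y) := rfl

theorem ext {x y : TwistedExt τ} (h1 : fst τ x = fst τ y) (h2 : snd τ x = snd τ y) : x = y :=
  TrivSqZeroExt.ext (R := B) (M := RightTwist τ) h1 h2

theorem inl_injective : Function.Injective (inl τ) := fun a b h => by
  simpa using congrArg (fst τ) h

theorem eq_inl_add (x : TwistedExt τ) : x = inl τ (fst τ x) + mk τ (0, snd τ x) :=
  ext (by simp) (by simp)

end TwistedExt

end TwistedExt

theorem isInternal_of_projections {F : Type v} {A : Type u} [Field F] [AddCommGroup A] [Module F A]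
    (deg : ℕ → Submodule F A) (p : ℕ → A →ₗ[F] A) (h1 : ∀ n, ∀ a ∈ deg n, p n a = a)
    (h2 : ∀ m n, m ≠ n → ∀ a ∈ deg m, p n a = 0) (h3 : iSup deg = ⊤) :
    DirectSum.IsInternal deg := by
  rw [DirectSum.isInternal_submodule_iff_iSupIndep_and_iSup_eq_top]
  refine ⟨fun n => ?_, h3⟩
  rw [Submodule.disjoint_def]
  intro a ha ha'
  have h : (⨆ (j) (_ : j ≠ n), deg j) ≤ LinearMap.ker (p n) :=
    iSup₂_le fun j hj b hb => h2 j n hj b hb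
  rw [← h1 n a ha]
  exact h ha'

namespace DifferentialCalculus

open AddMonoidAlgebra

variable {F : Type v} {R : Type u} {Ω : Type w} [Field F] [Ring R] [Algebra F R] [Ring Ω]
  [Algebra F Ω] (c : DifferentialCalculus F R Ω)
variable {M : Type*} [AddCommMonoid M] (X : ExponentMonoid M) (q : Fˣ)

/-! ### The calculus over the polynomial extension -/

/-- The underlying algebra `Ω[M] ⊕ Ω[M] dx` of the calculus over `R[M]`, where
`dx · ω xᵐ = (-1)ⁿ qᵐ ω xᵐ dx` for `ω ∈ Ωⁿ`. -/
abbrev PolyForms : Type _ := TwistedExt (F := F) (c.twist X q).toAlgHom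

/-- The coefficients of `dx` in a form of degree `n`. -/
noncomputable def polyDegPred (M : Type*) [AddCommMonoid M] : ℕ → Submodule F (AddMonoidAlgebra Ω M)
  | 0 => ⊥
  | n + 1 => c.polyDeg M n

/-- The forms `b + m dx` of degree `n`. -/
noncomputable def extDeg (n : ℕ) : Submodule F (c.PolyForms X q) :=
  (c.polyDeg M n).comap (TwistedExt.fst _) ⊓ (c.polyDegPred M n).comap (TwistedExt.snd _)

variable {X q}

theorem inl_mem_extDeg {n : ℕ} {b : AddMonoidAlgebra Ω M} (hb : b ∈ c.polyDeg M n) :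
    (TwistedExt.inl _ b : c.PolyForms X q) ∈ c.extDeg X q n :=
  ⟨hb, zero_mem (c.polyDegPred M n)⟩

theorem mk_mem_extDeg {n : ℕ} {b : AddMonoidAlgebra Ω M} (hb : b ∈ c.polyDeg M n) :
    (TwistedExt.mk _ (0, b) : c.PolyForms X q) ∈ c.extDeg X q (n + 1) :=
  ⟨zero_mem (c.polyDeg M (n + 1)), hb⟩

theorem polyDeg_mul_mem {i j : ℕ} {a b : AddMonoidAlgebra Ω M} (ha : a ∈ c.polyDeg M i)
    (hb : b ∈ c.polyDeg M j) : a * b ∈ c.polyDeg M (i + j) :=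
  withCoeffs_mul_mem (fun _ h _ h' => c.mul_mem h h') ha hb

theorem polyDeg_mul_polyDegPred_mem {i j : ℕ} {a b : AddMonoidAlgebra Ω M}
    (ha : a ∈ c.polyDeg M i) (hb : b ∈ c.polyDegPred M j) : a * b ∈ c.polyDegPred M (i + j) := by
  cases j with
  | zero =>
    rw [(Submodule.mem_bot F).1 hb, mul_zero]
    exact zero_mem _
  | succ j => exact c.polyDeg_mul_mem ha hb

theorem polyDegPred_mul_polyDeg_mem {i j : ℕ} {a b : AddMonoidAlgebra Ω M}
    (ha : a ∈ c.polyDegPred M i) (hb : b ∈ c.polyDeg M j) : a * b ∈ c.polyDegPred M (i + j) := by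
  cases i with
  | zero =>
    rw [(Submodule.mem_bot F).1 ha, zero_mul]
    exact zero_mem _
  | succ i =>
    rw [Nat.succ_add]
    exact c.polyDeg_mul_mem ha hb

theorem coeffwise_d_mem {n : ℕ} {b : AddMonoidAlgebra Ω M} (hb : b ∈ c.polyDeg M n) :
    coeffwise c.d b ∈ c.polyDeg M (n + 1) :=
  coeffwise_mem_withCoeffs (fun _ h => c.d_mem h) hb

theorem extDeg_mul_mem {i j : ℕ} {x y : c.PolyForms X q} (hx : x ∈ c.extDeg X q i)
    (hy : y ∈ c.extDeg X q j) : x * y ∈ c.extDeg X q (i + j) :=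
  ⟨c.polyDeg_mul_mem hx.1 hy.1, add_mem (c.polyDeg_mul_polyDegPred_mem hx.1 hy.2)
    (c.polyDegPred_mul_polyDeg_mem hx.2 (c.twist_mem X hy.1))⟩

theorem single_eq_single_one_mul (m : M) (ω : Ω) :
    (single m ω : AddMonoidAlgebra Ω M) = single m 1 * single 0 ω := by
  rw [single_mul_single, add_zero, one_mul]

variable (X q)

theorem isInternal_extDeg : DirectSum.IsInternal (c.extDeg X q) := by
  let p : ℕ → AddMonoidAlgebra Ω M →ₗ[F] AddMonoidAlgebra Ω M := fun n =>
    n.casesOn 0 fun n => coeffwise (c.proj n)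
  have p_succ (n : ℕ) : p (n + 1) = coeffwise (c.proj n) := rfl
  have hp1 (n : ℕ) (b : AddMonoidAlgebra Ω M) (hb : b ∈ c.polyDeg M n) :
      coeffwise (c.proj n) b = b := by
    ext m
    exact c.proj_of_mem (hb m)
  have hp2 (m n : ℕ) (hmn : m ≠ n) (b : AddMonoidAlgebra Ω M) (hb : b ∈ c.polyDeg M m) :
      coeffwise (c.proj n) b = 0 := by
    ext k
    exact c.proj_of_mem_of_ne (hb k) hmn
  refine isInternal_of_projections _ (fun n => TwistedExt.mk _ ∘ₗ LinearMap.prod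
    (coeffwise (c.proj n) ∘ₗ TwistedExt.fst _) (p n ∘ₗ TwistedExt.snd _)) ?_ ?_ ?_
  · rintro n x ⟨h1, h2⟩
    refine TwistedExt.ext (hp1 n _ h1) ?_
    change p n (TwistedExt.snd _ x) = TwistedExt.snd _ x
    cases n with
    | zero =>
      rw [(Submodule.mem_bot F).1 h2, map_zero]
    | succ n => exact hp1 n _ h2
  · rintro m n hmn x ⟨h1, h2⟩
    refine TwistedExt.ext (hp2 m n hmn _ h1) ?_
    change p n (TwistedExt.snd _ x) = 0
    cases m with
    | zero => rw [(Submodule.mem_bot F).1 h2, map_zero]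
    | succ m =>
      cases n with
      | zero => rfl
      | succ n => exact hp2 m n (by omega) _ h2
  · rw [eq_top_iff]
    intro x _
    rw [TwistedExt.eq_inl_add x]
    refine add_mem ?_ ?_
    · generalize TwistedExt.fst _ x = b
      induction b using AddMonoidAlgebra.induction_linear with
      | zero => rw [map_zero]; exact zero_mem _
      | add a b ha hb => rw [map_add]; exact add_mem ha hb
      | single m ω =>
        induction ω using c.homogeneous_induction with
        | zero => rw [single_zero, map_zero]; exact zero_mem _
        | add a b ha hb => rw [single_add, map_add]; exact add_mem ha hb
        | mem n ω h =>
          exact Submodule.mem_iSup_of_mem n (c.inl_mem_extDeg (single_mem_withCoeffs h m))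
    · generalize TwistedExt.snd _ x = b
      change (TwistedExt.mk _ ∘ₗ LinearMap.inr F _ _) b ∈ _
      induction b using AddMonoidAlgebra.induction_linear with
      | zero => rw [map_zero]; exact zero_mem _
      | add a b ha hb => rw [map_add]; exact add_mem ha hb
      | single m ω =>
        induction ω using c.homogeneous_induction with
        | zero => rw [single_zero, map_zero]; exact zero_mem _
        | add a b ha hb => rw [single_add, map_add]; exact add_mem ha hb
        | mem n ω h =>
          exact Submodule.mem_iSup_of_mem (n + 1) (c.mk_mem_extDeg (single_mem_withCoeffs h m))

/-- The differential `b + m dx ↦ db + (∂b + dm) dx`. -/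
noncomputable def extD : c.PolyForms X q →ₗ[F] c.PolyForms X q :=
  TwistedExt.mk _ ∘ₗ LinearMap.prod (coeffwise c.d ∘ₗ TwistedExt.fst _)
    (c.qDeriv X q ∘ₗ TwistedExt.fst _ + coeffwise c.d ∘ₗ TwistedExt.snd _)

variable {X q}

@[simp] theorem fst_extD (x : c.PolyForms X q) :
    TwistedExt.fst _ (c.extD X q x) = coeffwise c.d (TwistedExt.fst _ x) := rfl

@[simp] theorem snd_extD (x : c.PolyForms X q) :
    TwistedExt.snd _ (c.extD X q x) =
      c.qDeriv X q (TwistedExt.fst _ x) + coeffwise c.d (TwistedExt.snd _ x) := rfl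

theorem extD_mem {n : ℕ} {x : c.PolyForms X q} (hx : x ∈ c.extDeg X q n) :
    c.extD X q x ∈ c.extDeg X q (n + 1) := by
  refine ⟨c.coeffwise_d_mem hx.1, add_mem (c.qDeriv_mem X hx.1) ?_⟩
  cases n with
  | zero =>
    have h : TwistedExt.snd _ x = 0 := (Submodule.mem_bot F).1 hx.2
    rw [LinearMap.comp_apply, h, map_zero]
    exact zero_mem _
  | succ n => exact c.coeffwise_d_mem hx.2

theorem coeffwise_d_d (b : AddMonoidAlgebra Ω M) : coeffwise c.d (coeffwise c.d b) = 0 := by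
  ext m
  simp [c.d_d]

theorem extD_extD (x : c.PolyForms X q) : c.extD X q (c.extD X q x) = 0 :=
  TwistedExt.ext (by simp [coeffwise_d_d])
    (by simp [coeffwise_d_d, qDeriv_coeffwise_d])

theorem coeffwise_parity_of_mem {n : ℕ} {b : AddMonoidAlgebra Ω M} (hb : b ∈ c.polyDeg M n) :
    coeffwise c.parity.toLinearMap b = (-1) ^ n * b := by
  have : coeffwise c.parity.toLinearMap b = (-1 : F) ^ n • b := by
    ext m
    exact c.parity_of_mem (hb m)
  rw [this]
  rcases Nat.even_or_odd n with hn | hn <;> simp [hn.neg_one_pow]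

theorem extD_mul {n : ℕ} {x : c.PolyForms X q} (y : c.PolyForms X q) (hx : x ∈ c.extDeg X q n) :
    c.extD X q (x * y) = c.extD X q x * y + (-1) ^ n * (x * c.extD X q y) := by
  have h1 := c.coeffwise_parity_of_mem hx.1
  have h2 : coeffwise c.parity.toLinearMap (TwistedExt.snd _ x) =
      -((-1) ^ n * TwistedExt.snd _ x) := by
    cases n with
    | zero => rw [(Submodule.mem_bot F).1 hx.2]; simp
    | succ n => rw [c.coeffwise_parity_of_mem hx.2, pow_succ]; simp
  have h3 : ((-1) ^ n : c.PolyForms X q) = TwistedExt.inl _ ((-1) ^ n) := by simp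
  rw [h3]
  have h4 (b : AddMonoidAlgebra Ω M) : (c.twist X q).toAlgHom b = c.twist X q b := rfl
  refine TwistedExt.ext ?_ ?_
  · simp only [fst_extD, TwistedExt.fst_mul, TwistedExt.fst_inl, map_add, c.coeffwise_d_mul, h1,
      mul_assoc]
  · simp only [fst_extD, snd_extD, TwistedExt.fst_mul, TwistedExt.snd_mul, TwistedExt.fst_inl,
      TwistedExt.snd_inl, map_add, c.qDeriv_mul, c.coeffwise_d_mul, h1, h2, h4,
      c.coeffwise_d_twist]
    noncomm_ring

theorem extDeg_zero :
    LinearMap.range ((TwistedExt.inl (F := F) (c.twist X q).toAlgHom).comp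
      (mapAlgHom M c.ι)).toLinearMap = c.extDeg X q 0 := by
  classical
  apply le_antisymm
  · rintro _ ⟨r, rfl⟩
    refine c.inl_mem_extDeg fun m => ?_
    change (mapAlgHom M c.ι r).coeff m ∈ c.deg 0
    rw [coeff_mapAlgHom]
    exact c.ι_mem _
  · rintro x ⟨h1, h2⟩
    choose r hr using fun m => c.mem_deg_zero.1 (h1 m)
    refine ⟨ofCoeff (Finsupp.onFinset (TwistedExt.fst _ x).coeff.support r fun m hm => ?_), ?_⟩
    · rw [Finsupp.mem_support_iff, ← hr m]
      exact fun h => hm (c.ι_injective (h.trans c.ι.map_zero.symm))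
    · refine TwistedExt.ext ?_ ((Submodule.mem_bot F).1 h2).symm
      ext m
      change (mapAlgHom M c.ι _).coeff m = _
      rw [coeff_mapAlgHom]
      exact hr m

end DifferentialCalculus

namespace DifferentialCalculus

open AddMonoidAlgebra

variable {F : Type v} {R : Type u} {Ω : Type w} [Field F] [Ring R] [Algebra F R] [Ring Ω]
  [Algebra F Ω] (c : DifferentialCalculus F R Ω)
variable {M : Type*} [AddCommMonoid M] (X : ExponentMonoid M) (q : Fˣ)

/-- The inclusion of `R[M]` in the algebra of forms over it. -/
noncomputable def extι : AddMonoidAlgebra R M →ₐ[F] c.PolyForms X q :=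
  (TwistedExt.inl _).comp (mapAlgHom M c.ι)

variable {X q}

theorem extι_apply (r : AddMonoidAlgebra R M) :
    c.extι X q r = TwistedExt.inl _ (mapAlgHom M c.ι r) := rfl

theorem extι_single (m : M) (r : R) :
    c.extι X q (single m r) = TwistedExt.inl _ (single m (c.ι r)) := by
  rw [extι_apply, mapAlgHom_single]

theorem extι_injective : Function.Injective (c.extι X q : AddMonoidAlgebra R M → _) := by
  refine TwistedExt.inl_injective.comp fun r s h => ?_
  ext m
  have : (mapAlgHom M c.ι r).coeff m = (mapAlgHom M c.ι s).coeff m :=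
    congrArg (fun b => b.coeff m) h
  rw [coeff_mapAlgHom, coeff_mapAlgHom] at this
  exact c.ι_injective this

theorem extD_inl_single_zero (ω : Ω) :
    c.extD X q (TwistedExt.inl _ (single 0 ω)) = TwistedExt.inl _ (single 0 (c.d ω)) :=
  TwistedExt.ext (by simp) (by simp [qDeriv_single, X.qInt_zero])

theorem extD_extι_gen (hq : q ≠ 1) :
    c.extD X q (c.extι X q (single X.gen 1)) = TwistedExt.mk _ (0, 1) := by
  rw [extι_single, map_one]
  refine TwistedExt.ext ?_ ?_
  · simp [c.d_one]
  · simp [qDeriv_single, X.qInt_gen hq, X.pred_gen, AddMonoidAlgebra.one_def]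

/-- The density condition: `Ω[M]` is generated by monomials and `Ω`, for which it is known, and
`dx` is the differential of `x`. -/
theorem extDeg_eq (hq : q ≠ 1) (n : ℕ) :
    c.extDeg X q n = LinearMap.range (c.extι X q).toLinearMap *
      (LinearMap.range (c.extD X q ∘ₗ (c.extι X q).toLinearMap)) ^ n := by
  set I := LinearMap.range (c.extι X q).toLinearMap with hI
  set D := LinearMap.range (c.extD X q ∘ₗ (c.extι X q).toLinearMap) with hD
  have hI0 : I = c.extDeg X q 0 := c.extDeg_zero
  have hII : I * I ≤ I := by
    rw [Submodule.mul_le]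
    rintro _ ⟨r, rfl⟩ _ ⟨s, rfl⟩
    exact ⟨r * s, map_mul (c.extι X q) r s⟩
  have hD1 : D ≤ c.extDeg X q 1 := by
    rintro _ ⟨r, rfl⟩
    refine c.extD_mem (n := 0) ?_
    rw [← hI0]
    exact ⟨r, rfl⟩
  let J : Ω →ₐ[F] c.PolyForms X q := (TwistedExt.inl _).comp singleZeroAlgHom
  have hJI : (LinearMap.range c.ι.toLinearMap).map J.toLinearMap ≤ I := by
    rintro _ ⟨_, ⟨r, rfl⟩, rfl⟩
    exact ⟨single 0 r, c.extι_single 0 r⟩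
  have hJD : (LinearMap.range (c.d ∘ₗ c.ι.toLinearMap)).map J.toLinearMap ≤ D := by
    rintro _ ⟨_, ⟨r, rfl⟩, rfl⟩
    refine ⟨single 0 r, ?_⟩
    change c.extD X q (c.extι X q _) = _
    rw [extι_single, extD_inl_single_zero]
    rfl
  have hJ (k : ℕ) : (c.deg k).map J.toLinearMap ≤ I * D ^ k := by
    rw [c.density, Submodule.map_mul, Submodule.map_pow]
    refine mul_le_mul' hJI ?_
    clear hI hD
    induction k with
    | zero => simp
    | succ k ih => rw [pow_succ, pow_succ]; exact mul_le_mul' ih hJD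
  have hinl (k : ℕ) (b : AddMonoidAlgebra Ω M) (hb : b ∈ c.polyDeg M k) :
      TwistedExt.inl _ b ∈ I * D ^ k := by
    refine withCoeffs_induction (p := fun b => TwistedExt.inl _ b ∈ I * D ^ k)
      (by rw [map_zero]; exact zero_mem _)
      (fun b _ b' _ h h' => by rw [map_add]; exact add_mem h h') (fun m ω hω => ?_) hb
    rw [single_eq_single_one_mul, map_mul]
    have h1 : TwistedExt.inl (c.twist X q).toAlgHom (single m (1 : Ω)) ∈ I :=
      ⟨single m 1, by
        change c.extι X q _ = _
        rw [extι_single, map_one]⟩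
    have h2 := Submodule.mul_mem_mul h1 (hJ k ⟨ω, hω, rfl⟩)
    rw [← mul_assoc] at h2
    exact mul_le_mul_left hII _ h2
  apply le_antisymm
  · rintro x ⟨h1, h2⟩
    rw [TwistedExt.eq_inl_add x]
    refine add_mem (hinl n _ h1) ?_
    cases n with
    | zero =>
      have h : TwistedExt.snd _ x = 0 := (Submodule.mem_bot F).1 h2
      rw [h, show ((0 : AddMonoidAlgebra Ω M), (0 : AddMonoidAlgebra Ω M)) = 0 from rfl, map_zero]
      exact zero_mem _
    | succ n =>
      have e : TwistedExt.mk _ (0, TwistedExt.snd _ x) =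
          TwistedExt.inl _ (TwistedExt.snd _ x) *
            c.extD X q (c.extι X q (single X.gen 1)) := by
        rw [c.extD_extι_gen hq]
        exact TwistedExt.ext (by simp) (by simp)
      rw [e, pow_succ, ← mul_assoc]
      exact Submodule.mul_mem_mul (hinl n _ h2) ⟨_, rfl⟩
  · rw [hI0]
    clear hinl hJ hJD hI hD
    induction n with
    | zero => simp
    | succ n ih =>
      rw [pow_succ, ← mul_assoc, Submodule.mul_le]
      intro x hx y hy
      exact c.extDeg_mul_mem (ih hx) (hD1 hy)

variable (X)

/-- The calculus over `R[M]` generated by a calculus over `R` and a form `dx` with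
`dx · x = q x dx` that anticommutes with the forms of odd degree over `R`. -/
noncomputable def polyExt (hq : q ≠ 1) :
    DifferentialCalculus F (AddMonoidAlgebra R M) (c.PolyForms X q) where
  deg := c.extDeg X q
  isInternal := c.isInternal_extDeg X q
  one_mem := ⟨single_mem_withCoeffs c.one_mem 0, zero_mem (c.polyDegPred M 0)⟩
  mul_mem := c.extDeg_mul_mem
  ι := c.extι X q
  ι_injective := c.extι_injective
  range_ι := c.extDeg_zero
  d := c.extD X q
  d_mem := c.extD_mem
  d_d := c.extD_extD
  leibniz := c.extD_mul
  density := c.extDeg_eq hq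

variable {X}

/-! ### Connectedness and dimension -/

theorem isConnected_polyExt (hc : c.IsConnected) (hq : ¬ IsOfFinOrder q) (hq1 : q ≠ 1) :
    (c.polyExt X hq1).IsConnected := by
  classical
  intro r
  constructor
  · intro h
    have hD : c.qDeriv X q (mapAlgHom M c.ι r) = 0 := by
      have := congrArg (TwistedExt.snd _) h
      change c.qDeriv X q (mapAlgHom M c.ι r) + coeffwise c.d 0 = 0 at this
      simpa using this
    have hd : coeffwise c.d (mapAlgHom M c.ι r) = 0 := congrArg (TwistedExt.fst _) h
    have h0 := congrArg (fun b => b.coeff 0) hd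
    rw [coeff_coeffwise, coeff_mapAlgHom] at h0
    obtain ⟨a, ha⟩ := (hc _).1 h0
    refine ⟨a, ?_⟩
    ext m
    rw [AddMonoidAlgebra.coe_algebraMap, Function.comp_apply, coeff_single, Finsupp.single_apply]
    split_ifs with hm
    · rw [← hm, ha]
    · have := c.coeff_eq_zero_of_qDeriv_eq_zero X hq hD (Ne.symm hm)
      rw [coeff_mapAlgHom] at this
      exact c.ι_injective (this.trans c.ι.map_zero.symm)
  · rintro ⟨a, rfl⟩
    rw [AlgHom.commutes, Algebra.algebraMap_eq_smul_one, map_smul, d_one, smul_zero]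

theorem hasDimension_polyExt {N : ℕ} (h : c.HasDimension N) (hq : q ≠ 1) :
    (c.polyExt X hq).HasDimension (N + 1) := by
  have h0 (n : ℕ) (hn : N < n) : c.polyDeg M n = ⊥ := withCoeffs_eq_bot_iff.2 (h.2 n hn)
  constructor
  · intro h'
    refine h.1 ((withCoeffs_eq_bot_iff (M := M)).1 ?_)
    rw [Submodule.eq_bot_iff]
    intro b hb
    have hb' : TwistedExt.mk _ (0, b) ∈ (c.polyExt X hq).deg (N + 1) := c.mk_mem_extDeg hb
    rw [h', Submodule.mem_bot] at hb'
    exact congrArg (TwistedExt.snd _) hb'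
  · intro n hn
    rw [Submodule.eq_bot_iff]
    rintro x ⟨h1, h2⟩
    obtain ⟨n, rfl⟩ : ∃ k, n = k + 1 := ⟨n - 1, by omega⟩
    have h2' : TwistedExt.snd _ x ∈ c.polyDeg M n := h2
    have h1' : TwistedExt.fst _ x ∈ c.polyDeg M (n + 1) := h1
    rw [h0 _ (by omega), Submodule.mem_bot] at h1' h2'
    exact TwistedExt.ext h1' h2'

/-! ### Volume forms and integrability -/

theorem existsUnique_mapAlgHom_of_coeff {f : Ω → Ω} (hf0 : f 0 = 0) {b : AddMonoidAlgebra Ω M}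
    (h : ∀ m, ∃! r, f (c.ι r) = b.coeff m) :
    ∃! r : AddMonoidAlgebra R M, ∀ m, f ((mapAlgHom M c.ι r).coeff m) = b.coeff m := by
  classical
  choose r hr hu using h
  refine ⟨ofCoeff (Finsupp.onFinset b.coeff.support r fun m hm => ?_), fun m => ?_, fun s hs => ?_⟩
  · rw [Finsupp.mem_support_iff]
    intro h0
    refine hm ?_
    rw [← hu m 0 (by beta_reduce; rw [map_zero, hf0, h0])]
  · rw [coeff_mapAlgHom]
    exact hr m
  · ext m
    refine hu m _ ?_
    beta_reduce
    rw [← coeff_mapAlgHom]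
    exact hs m

theorem existsUnique_single_mul {N : ℕ} {ω : Ω} (h : c.IsVolumeForm N ω)
    {b : AddMonoidAlgebra Ω M} (hb : b ∈ c.polyDeg M N) :
    ∃! r : AddMonoidAlgebra R M, single 0 ω * mapAlgHom M c.ι r = b := by
  have := c.existsUnique_mapAlgHom_of_coeff (f := fun η => ω * η) (mul_zero _)
    (fun m => h.right_free _ (hb m))
  refine (existsUnique_congr fun r => ?_).1 this
  rw [← coeff_inj, DFunLike.ext_iff]
  simp only [coeff_single_zero_mul]

theorem existsUnique_mul_single {N : ℕ} {ω : Ω} (h : c.IsVolumeForm N ω)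
    {b : AddMonoidAlgebra Ω M} (hb : b ∈ c.polyDeg M N) :
    ∃! r : AddMonoidAlgebra R M, mapAlgHom M c.ι r * single 0 ω = b := by
  have := c.existsUnique_mapAlgHom_of_coeff (f := fun η => η * ω) (zero_mul _)
    (fun m => h.left_free _ (hb m))
  refine (existsUnique_congr fun r => ?_).1 this
  rw [← coeff_inj, DFunLike.ext_iff]
  simp only [coeff_mul_single_zero]

theorem isVolumeForm_polyExt {N : ℕ} {ω : Ω} (h : c.IsVolumeForm N ω) (hN : c.HasDimension N)
    (hq : q ≠ 1) :
    (c.polyExt X hq).IsVolumeForm (N + 1) (TwistedExt.mk _ (0, single 0 ω)) := by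
  have hfst (x : c.PolyForms X q) (hx : x ∈ c.extDeg X q (N + 1)) : TwistedExt.fst _ x = 0 := by
    have := hx.1
    have h0 : c.polyDeg M (N + 1) = ⊥ := withCoeffs_eq_bot_iff.2 (hN.2 _ (by omega))
    rwa [SetLike.mem_coe, h0] at this
  refine ⟨c.mk_mem_extDeg (single_mem_withCoeffs h.mem 0), fun x hx => ?_, fun x hx => ?_⟩
  · -- moving `dx` to the right of the scalar twists the equation to be solved by `τ`
    have hx2 : (-1 : F) ^ N • (c.twist X q).symm (TwistedExt.snd _ x) ∈ c.polyDeg M N :=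
      Submodule.smul_mem _ _ (c.twist_symm_mem X hx.2)
    refine (existsUnique_congr fun r => ?_).1 (c.existsUnique_single_mul h hx2)
    have e : (c.twist X q).symm (single 0 ω) = (-1 : F) ^ N • single 0 ω := by
      rw [twist_symm, twist_single, c.parity_of_mem h.mem]
      simp
    have hs : ((-1 : F) ^ N) * (-1) ^ N = 1 := by rw [← mul_pow]; simp
    have h1 : single 0 ω * mapAlgHom M c.ι r = (-1 : F) ^ N •
          (c.twist X q).symm (TwistedExt.snd _ x) ↔
        (c.twist X q).symm (single 0 ω) * mapAlgHom M c.ι r =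
          (c.twist X q).symm (TwistedExt.snd _ x) := by
      rw [e, smul_mul_assoc]
      constructor
      · intro h2
        rw [h2, smul_smul, hs, one_smul]
      · intro h2
        rw [← h2, smul_smul, hs, one_smul]
    rw [h1, AlgEquiv.eq_symm_apply, map_mul, AlgEquiv.apply_symm_apply]
    constructor
    · intro h2
      refine TwistedExt.ext ?_ ?_
      · rw [hfst x hx, TwistedExt.fst_mul, TwistedExt.fst_mk, zero_mul]
      · rw [TwistedExt.snd_mul, TwistedExt.fst_mk, zero_mul, zero_add]
        exact h2
    · intro h2
      have h3 := congrArg (TwistedExt.snd _) h2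
      rw [TwistedExt.snd_mul, TwistedExt.fst_mk, zero_mul, zero_add] at h3
      exact h3
  · refine (existsUnique_congr fun r => ?_).1 (c.existsUnique_mul_single h hx.2)
    constructor
    · intro h2
      refine TwistedExt.ext ?_ ?_
      · rw [hfst x hx, TwistedExt.fst_mul, TwistedExt.fst_mk, mul_zero]
      · rw [TwistedExt.snd_mul, TwistedExt.fst_mk, map_zero, mul_zero, add_zero]
        exact h2
    · intro h2
      have h3 := congrArg (TwistedExt.snd _) h2
      rw [TwistedExt.snd_mul, TwistedExt.fst_mk, map_zero, mul_zero, add_zero] at h3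
      exact h3

/-- The pairing `(a + b dx, η₁ + η₂ dx) ↦ (a η₂ + b τ(η₁)) dx` of forms of complementary degrees
over `R[M]` is the sum of two such pairings of forms with coefficients in `R[M]`. -/
theorem isDualPairing_polyExt {N : ℕ} (hN : c.HasDimension N) (hq : q ≠ 1)
    (H : ∀ k l, k + l = N → IsDualPairing (c.polyDeg M 0 : Set (AddMonoidAlgebra Ω M))
      (c.polyDeg M k) (c.polyDeg M l) (c.polyDeg M N)) (k l : ℕ) (hkl : k + l = N + 1) :
    IsDualPairing ((c.polyExt X hq).deg 0 : Set (c.PolyForms X q)) ((c.polyExt X hq).deg k)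
      ((c.polyExt X hq).deg l) ((c.polyExt X hq).deg (N + 1)) := by
  have hbot {b : AddMonoidAlgebra Ω M} (hb : b ∈ c.polyDeg M (N + 1)) : b = 0 := by
    have h0 : c.polyDeg M (N + 1) = ⊥ := withCoeffs_eq_bot_iff.2 (hN.2 _ (by omega))
    rwa [h0, Submodule.mem_bot] at hb
  have hτ (b : AddMonoidAlgebra Ω M) : (c.twist X q).toAlgHom ((c.twist X q).symm b) = b :=
    (c.twist X q).apply_symm_apply b
  refine ⟨?_, ?_⟩
  · rintro γ ⟨hγ1, hγ2⟩ h0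
    refine TwistedExt.ext ?_ ?_
    · cases l with
      | zero => exact hbot (by rwa [← hkl])
      | succ l =>
        refine (H k l (by omega)).separating _ hγ1 fun η hη => ?_
        have := congrArg (TwistedExt.snd _) (h0 _ (c.mk_mem_extDeg hη))
        rwa [TwistedExt.snd_mul, TwistedExt.fst_mk, TwistedExt.snd_mk, map_zero, mul_zero,
          add_zero] at this
    · cases k with
      | zero => exact (Submodule.mem_bot F).1 hγ2
      | succ k =>
        refine (H k l (by omega)).separating _ hγ2 fun η hη => ?_
        have := congrArg (TwistedExt.snd _)
          (h0 _ (c.inl_mem_extDeg (c.twist_symm_mem X (q := q) hη)))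
        rwa [TwistedExt.snd_mul, TwistedExt.fst_inl, TwistedExt.snd_inl, hτ, mul_zero,
          zero_add] at this
  · intro φ hφ hadd hmul
    have hφ0 : φ 0 = 0 := by
      have := hadd 0 (zero_mem ((c.polyExt X hq).deg l)) 0 (zero_mem ((c.polyExt X hq).deg l))
      simpa using this
    obtain ⟨a, ha, ha'⟩ : ∃ a ∈ c.polyDeg M k, ∀ η ∈ c.polyDegPred M l,
        a * η = TwistedExt.snd _ (φ (TwistedExt.mk _ (0, η))) := by
      cases l with
      | zero =>
        refine ⟨0, zero_mem _, fun η hη => ?_⟩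
        rw [(Submodule.mem_bot F).1 hη,
          show ((0 : AddMonoidAlgebra Ω M), (0 : AddMonoidAlgebra Ω M)) = 0 from rfl, map_zero,
          hφ0, map_zero, mul_zero]
      | succ l =>
        refine (H k l (by omega)).represents
          (fun η => TwistedExt.snd _ (φ (TwistedExt.mk _ (0, η))))
          (fun η hη => (hφ (c.mk_mem_extDeg hη)).2) (fun η hη η' hη' => ?_) (fun η hη s hs => ?_)
        · rw [← map_add, ← hadd _ (c.mk_mem_extDeg hη) _ (c.mk_mem_extDeg hη'), ← map_add,
            Prod.mk_add_mk, add_zero]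
        · have e : (TwistedExt.mk _ (0, η * s) : c.PolyForms X q) =
              TwistedExt.mk _ (0, η) * TwistedExt.inl _ ((c.twist X q).symm s) :=
            TwistedExt.ext (by simp) (by simp [hτ])
          rw [e, hmul _ (c.mk_mem_extDeg hη) _ (c.inl_mem_extDeg (c.twist_symm_mem X hs)),
            TwistedExt.snd_mul, TwistedExt.snd_inl, TwistedExt.fst_inl, hτ, mul_zero, zero_add]
    obtain ⟨b, hb, hb'⟩ : ∃ b ∈ c.polyDegPred M k, ∀ η ∈ c.polyDeg M l,
        b * η = TwistedExt.snd _ (φ (TwistedExt.inl _ ((c.twist X q).symm η))) := by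
      cases k with
      | zero =>
        refine ⟨0, zero_mem _, fun η hη => ?_⟩
        obtain rfl : l = N + 1 := by omega
        rw [hbot hη, map_zero, map_zero, hφ0, map_zero, mul_zero]
      | succ k =>
        refine (H k l (by omega)).represents
          (fun η => TwistedExt.snd _ (φ (TwistedExt.inl _ ((c.twist X q).symm η))))
          (fun η hη => (hφ (c.inl_mem_extDeg (c.twist_symm_mem X hη))).2)
          (fun η hη η' hη' => ?_) (fun η hη s hs => ?_)
        · rw [← map_add, ← hadd _ (c.inl_mem_extDeg (c.twist_symm_mem X hη)) _
            (c.inl_mem_extDeg (c.twist_symm_mem X hη')), ← map_add, ← map_add]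
        · rw [map_mul, map_mul, hmul _ (c.inl_mem_extDeg (c.twist_symm_mem X hη)) _
            (c.inl_mem_extDeg (c.twist_symm_mem X hs)),
            TwistedExt.snd_mul, TwistedExt.snd_inl, TwistedExt.fst_inl, hτ, mul_zero, zero_add]
    refine ⟨TwistedExt.mk _ (a, b), ⟨ha, hb⟩, ?_⟩
    rintro η ⟨h1, h2⟩
    refine TwistedExt.ext ?_ ?_
    · rw [hbot (hφ ⟨h1, h2⟩).1]
      refine hbot ?_
      rw [← hkl]
      exact c.polyDeg_mul_mem ha h1
    · have hmk : (TwistedExt.mk _ (0, TwistedExt.snd _ η) : c.PolyForms X q) ∈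
          (c.polyExt X hq).deg l := ⟨zero_mem (c.polyDeg M l), h2⟩
      conv_rhs => rw [TwistedExt.eq_inl_add η, hadd _ (c.inl_mem_extDeg h1) _ hmk, map_add,
        ← ha' _ h2]
      have h3 := hb' _ (c.twist_mem X (q := q) h1)
      rw [AlgEquiv.symm_apply_apply] at h3
      rw [← h3, add_comm]
      rfl

theorem isIntegrable_polyExt {N : ℕ} (hfin : Module.Finite Rᵐᵒᵖ c.Forms) (hN : c.HasDimension N)
    (h : c.IsIntegrable N) (hq : q ≠ 1) : (c.polyExt X hq).IsIntegrable (N + 1) := by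
  rw [isIntegrable_iff] at h ⊢
  obtain ⟨ω, hω, h⟩ := h
  exact ⟨_, c.isVolumeForm_polyExt hω hN hq, fun k l hkl => c.isDualPairing_polyExt hN hq
    (fun k l hkl => c.isDualPairing_polyDeg hfin (h k l hkl)) k l hkl⟩

/-! ### Finite generation of the extended calculus -/

theorem finite_forms_polyExt (hfin : Module.Finite Rᵐᵒᵖ c.Forms) (hq : q ≠ 1) :
    Module.Finite (AddMonoidAlgebra R M)ᵐᵒᵖ (c.polyExt X hq).Forms := by
  classical
  rw [finite_forms_iff] at hfin ⊢
  obtain ⟨s, hs⟩ := hfin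
  let i : Ω →ₗ[F] c.PolyForms X q := (TwistedExt.inl _).toLinearMap ∘ₗ lsingle 0
  let j : Ω →ₗ[F] c.PolyForms X q := TwistedExt.mk _ ∘ₗ LinearMap.inr F _ _ ∘ₗ lsingle 0
  refine ⟨s.image i ∪ s.image j, fun P h1 h2 => ?_⟩
  have hi (ω : Ω) : i ω ∈ P := by
    have := hs (P.comap i.toAddMonoidHom)
      (fun ω hω => h1 (Finset.mem_union_left _ (Finset.mem_image_of_mem _ hω)))
      (fun ω hω r => by
        have e : i (ω * c.ι r) = i ω * c.extι X q (single 0 r) := by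
          rw [extι_single]
          exact TwistedExt.ext (by simp [i, single_mul_single]) (by simp [i])
        change i (ω * c.ι r) ∈ P
        rw [e]
        exact h2 _ hω _)
    have h : ω ∈ P.comap i.toAddMonoidHom := this ▸ AddSubgroup.mem_top _
    exact h
  have hτ (m : M) (a : F) (r : R) :
      (c.twist X q).toAlgHom (single m (c.ι (a • r))) =
        single m (((q ^ X.toInt m : Fˣ) : F) • a • c.ι r) := by
    refine (c.twist_single X q m _).trans ?_
    rw [c.parity_of_mem (c.ι_mem _), pow_zero, one_smul, map_smul]
  have hj (ω : Ω) : j ω ∈ P := by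
    have := hs (P.comap j.toAddMonoidHom)
      (fun ω hω => h1 (Finset.mem_union_right _ (Finset.mem_image_of_mem _ hω)))
      (fun ω hω r => by
        have e : j (ω * c.ι r) = j ω * c.extι X q (single 0 r) := by
          have := hτ 0 1 r
          rw [one_smul, one_smul, map_zero, zpow_zero, Units.val_one, one_smul] at this
          rw [extι_single]
          refine TwistedExt.ext (by simp [j]) ?_
          rw [TwistedExt.snd_mul, TwistedExt.fst_inl, this]
          simp [j, single_mul_single]
        change j (ω * c.ι r) ∈ P
        rw [e]
        exact h2 _ hω _)
    have h : ω ∈ P.comap j.toAddMonoidHom := this ▸ AddSubgroup.mem_top _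
    exact h
  rw [eq_top_iff]
  intro x _
  rw [TwistedExt.eq_inl_add x]
  refine add_mem ?_ ?_
  · generalize TwistedExt.fst _ x = b
    induction b using AddMonoidAlgebra.induction_linear with
    | zero => rw [map_zero]; exact zero_mem _
    | add a b ha hb => rw [map_add]; exact add_mem ha hb
    | single m ω =>
      have e : TwistedExt.inl _ (single m ω) = i ω * c.extι X q (single m 1) := by
        rw [extι_single, map_one]
        exact TwistedExt.ext (by simp [i, single_mul_single]) (by simp [i])
      rw [e]
      exact h2 _ (hi ω) _
  · generalize TwistedExt.snd _ x = b
    change (TwistedExt.mk _ ∘ₗ LinearMap.inr F _ _) b ∈ _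
    induction b using AddMonoidAlgebra.induction_linear with
    | zero => rw [map_zero]; exact zero_mem _
    | add a b ha hb => rw [map_add]; exact add_mem ha hb
    | single m ω =>
      -- the scalar `q⁻ᵐ` compensates for moving `xᵐ` past `dx`
      have e : TwistedExt.mk _ (0, single m ω) =
          j ω * c.extι X q (single m (((q ^ X.toInt m)⁻¹ : Fˣ) • (1 : R))) := by
        rw [extι_single]
        refine TwistedExt.ext (by simp [j]) ?_
        rw [TwistedExt.snd_mul, TwistedExt.fst_inl, Units.smul_def, hτ, smul_smul,
          ← Units.val_mul, mul_inv_cancel, Units.val_one, one_smul, map_one]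
        simp [j, single_mul_single]
      change TwistedExt.mk _ (0, single m ω) ∈ P
      rw [e]
      exact h2 _ (hj ω) _

end DifferentialCalculus

/-! ### Gelfand–Kirillov dimension of polynomial extensions -/

section WordSpan

variable {F : Type v} {A : Type u} [Field F] [Ring A] [Algebra F A]

instance finite_wordSpan (s : Finset A) (n : ℕ) : Module.Finite F (wordSpan F s n) := by
  rw [Module.Finite.iff_fg]
  refine Submodule.FG.pow (Submodule.FG.sup ?_ ⟨s, rfl⟩) n
  rw [Submodule.one_eq_span]
  exact Submodule.fg_span_singleton 1

theorem subset_wordSpan_one {s : Finset A} {a : A} (h : a ∈ s) : a ∈ wordSpan F s 1 := by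
  rw [wordSpan, pow_one]
  exact Submodule.mem_sup_right (Submodule.subset_span h)

theorem one_mem_wordSpan (s : Finset A) (n : ℕ) : (1 : A) ∈ wordSpan F s n := by
  have h : (1 : Submodule F A) ≤ 1 ⊔ Submodule.span F (s : Set A) := le_sup_left
  have h1 : (1 : A) ∈ 1 ⊔ Submodule.span F (s : Set A) := h (Submodule.one_le.1 le_rfl)
  have h2 := Submodule.pow_mem_pow _ h1 n
  rwa [one_pow] at h2

theorem mul_mem_wordSpan {s : Finset A} {a b : A} {m n : ℕ} (ha : a ∈ wordSpan F s m)
    (hb : b ∈ wordSpan F s n) : a * b ∈ wordSpan F s (m + n) := by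
  rw [wordSpan, pow_add]
  exact Submodule.mul_mem_mul ha hb

theorem wordSpan_mono (s : Finset A) {m n : ℕ} (h : m ≤ n) : wordSpan F s m ≤ wordSpan F s n := by
  intro a ha
  have := mul_mem_wordSpan ha (one_mem_wordSpan (F := F) s (n - m))
  rwa [mul_one, Nat.add_sub_cancel' h] at this

theorem growthExponent_le_iff (s : Finset A) (e : ℝ) :
    growthExponent F s ≤ e ↔ ∀ t : ℝ, e < t → ∀ᶠ n : ℕ in Filter.atTop,
      (Module.finrank F (wordSpan F s n) : ℝ) ≤ (n : ℝ) ^ t := by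
  constructor
  · intro h t ht
    have : growthExponent F s < (t : EReal) := h.trans_lt (EReal.coe_lt_coe_iff.2 ht)
    obtain ⟨_, ⟨t', rfl, ht'⟩, hlt⟩ := sInf_lt_iff.1 this
    filter_upwards [ht', Filter.eventually_ge_atTop 1] with n hn hn1
    exact hn.trans (Real.rpow_le_rpow_of_exponent_le (by exact_mod_cast hn1)
      (EReal.coe_lt_coe_iff.1 hlt).le)
  · intro h
    refine le_of_forall_gt_imp_ge_of_dense fun a ha => ?_
    obtain ⟨t, ht, hta⟩ := EReal.lt_iff_exists_real_btwn.1 ha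
    refine le_trans (sInf_le ⟨t, rfl, h t (EReal.coe_lt_coe_iff.1 ht)⟩) hta.le

theorem GKdim_le_iff (e : ℝ) :
    GKdim F A ≤ e ↔ ∀ (s : Finset A) (t : ℝ), e < t → ∀ᶠ n : ℕ in Filter.atTop,
      (Module.finrank F (wordSpan F s n) : ℝ) ≤ (n : ℝ) ^ t := by
  rw [GKdim, iSup_le_iff]
  exact forall_congr' fun s => growthExponent_le_iff s e

end WordSpan

namespace ExponentMonoid

open AddMonoidAlgebra

variable {F : Type v} {R : Type u} [Field F] [Ring R] [Algebra F R]
variable {M : Type*} [AddCommMonoid M] (X : ExponentMonoid M)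

/-- The exponents of absolute value at most `k`. -/
noncomputable def ball (k : ℕ) : Finset M :=
  (Finset.Icc (-(k : ℤ)) k).preimage X.toInt X.toInt_injective.injOn

theorem mem_ball {k : ℕ} {m : M} : m ∈ X.ball k ↔ |X.toInt m| ≤ k := by
  rw [ball, Finset.mem_preimage, Finset.mem_Icc, abs_le]

theorem card_ball_le (k : ℕ) : (X.ball k).card ≤ 2 * k + 1 := by
  have := Finset.card_le_card_of_injOn X.toInt (s := X.ball k) (t := Finset.Icc (-(k : ℤ)) k)
    (fun m hm => by simpa [ball] using hm) X.toInt_injective.injOn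
  rw [Int.card_Icc] at this
  omega

/-- The elements of `R[M]` with coefficients in `W` and exponents of absolute value at most `k`. -/
noncomputable def box (W : Submodule F R) (k : ℕ) : Submodule F (AddMonoidAlgebra R M) :=
  withCoeffs W ⊓ supported F R (X.ball k : Set M)

theorem mul_mem_box {U V W : Submodule F R} (hUV : ∀ a ∈ U, ∀ b ∈ V, a * b ∈ W) {k l : ℕ}
    {x y : AddMonoidAlgebra R M} (hx : x ∈ X.box U k) (hy : y ∈ X.box V l) :
    x * y ∈ X.box W (k + l) := by
  classical
  refine ⟨withCoeffs_mul_mem hUV hx.1 hy.1, ?_⟩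
  have h := AddMonoidAlgebra.support_coeff_mul_subset x y
  change (↑(x * y).coeff.support : Set M) ⊆ _
  intro m hm
  obtain ⟨i, hi, j, hj, rfl⟩ := Finset.mem_add.1 (h hm)
  have hi' := X.mem_ball.1 (hx.2 hi)
  have hj' := X.mem_ball.1 (hy.2 hj)
  rw [Finset.mem_coe, mem_ball, map_add]
  push_cast
  exact (abs_add_le _ _).trans (add_le_add hi' hj')

theorem finrank_box_le (W : Submodule F R) [Module.Finite F W] (k : ℕ) (V : Submodule F _)
    (hV : V ≤ X.box W k) : Module.finrank F V ≤ (2 * k + 1) * Module.finrank F W := by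
  let f : V →ₗ[F] (X.ball k → W) :=
    { toFun := fun b m => ⟨b.1.coeff m, (hV b.2).1 m⟩
      map_add' := fun _ _ => rfl
      map_smul' := fun _ _ => rfl }
  have hf : Function.Injective f := by
    rw [injective_iff_map_eq_zero]
    intro b hb
    apply Subtype.ext
    ext m
    by_cases hm : m ∈ X.ball k
    · exact congrArg Subtype.val (congrFun hb ⟨m, hm⟩)
    · by_contra h
      exact hm ((hV b.2).2 (Finsupp.mem_support_iff.2 h))
  refine (LinearMap.finrank_le_finrank_of_injective hf).trans ?_
  rw [Module.finrank_pi_fintype, Finset.sum_const, Finset.card_univ, Fintype.card_coe, smul_eq_mul]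
  exact Nat.mul_le_mul_right _ (X.card_ball_le k)

/-- The words in a finite set `s` have coefficients that are words of the same length in the
coefficients of `s`, and exponents that grow at most linearly. -/
theorem exists_wordSpan_le_box (s : Finset (AddMonoidAlgebra R M)) :
    ∃ (S : Finset R) (k : ℕ), ∀ n, wordSpan F s n ≤ X.box (wordSpan F S n) (n * k) := by
  classical
  let S : Finset R := s.biUnion fun b => b.coeff.support.image b.coeff
  let k : ℕ := s.sup fun b => b.coeff.support.sup fun m => (X.toInt m).natAbs
  have hone (n k : ℕ) : (1 : AddMonoidAlgebra R M) ∈ X.box (wordSpan F S n) k := by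
    rw [AddMonoidAlgebra.one_def]
    refine ⟨single_mem_withCoeffs (one_mem_wordSpan S n) 0, fun m hm => ?_⟩
    have : m = 0 := Finset.mem_singleton.1 (Finsupp.support_single_subset hm)
    rw [this, Finset.mem_coe, mem_ball]
    simp
  refine ⟨S, k, fun n => ?_⟩
  have h1 : 1 ⊔ Submodule.span F (s : Set (AddMonoidAlgebra R M)) ≤ X.box (wordSpan F S 1) k := by
    refine sup_le (Submodule.one_le.2 (hone 1 k))
      (Submodule.span_le.2 fun b hb => ⟨fun m => ?_, ?_⟩)
    · by_cases hm : m ∈ b.coeff.support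
      · exact subset_wordSpan_one
          (Finset.mem_biUnion.2 ⟨b, hb, Finset.mem_image_of_mem _ hm⟩)
      · rw [Finsupp.notMem_support_iff.1 hm]
        exact zero_mem _
    · intro m hm
      rw [Finset.mem_coe, mem_ball, Int.abs_eq_natAbs]
      have h2 : (X.toInt m).natAbs ≤ k :=
        (Finset.le_sup (f := fun m => (X.toInt m).natAbs) hm).trans
          (Finset.le_sup (f := fun b : AddMonoidAlgebra R M =>
            b.coeff.support.sup fun m => (X.toInt m).natAbs) hb)
      exact_mod_cast h2
  induction n with
  | zero =>
    rw [wordSpan, pow_zero]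
    exact Submodule.one_le.2 (hone 0 _)
  | succ n ih =>
    rw [wordSpan, pow_succ, Submodule.mul_le, Nat.succ_mul]
    exact fun x hx y hy => X.mul_mem_box (fun _ ha _ hb => mul_mem_wordSpan ha hb) (ih hx) (h1 hy)

theorem GKdim_le_add_one (X : ExponentMonoid M) {e : ℝ} (h : GKdim F R ≤ e) :
    GKdim F (AddMonoidAlgebra R M) ≤ ((e + 1 : ℝ) : EReal) := by
  rw [GKdim_le_iff] at h ⊢
  intro s t ht
  obtain ⟨S, k, hS⟩ := X.exists_wordSpan_le_box (F := F) s
  -- half of the excess of `t` absorbs the constant `2 k + 1`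
  set ε : ℝ := (t - e - 1) / 2 with hε
  have hε0 : 0 < ε := by rw [hε]; linarith
  have hlim := (tendsto_rpow_atTop hε0).comp tendsto_natCast_atTop_atTop
  filter_upwards [h S (e + ε) (by linarith), Filter.eventually_ge_atTop 1,
    hlim.eventually_ge_atTop (2 * k + 1 : ℝ)] with n h1 hn1 h2
  have hn : (1 : ℝ) ≤ n := by exact_mod_cast hn1
  have h2' : (2 * k + 1 : ℝ) ≤ (n : ℝ) ^ ε := h2
  have h3 : (Module.finrank F (wordSpan F s n) : ℝ) ≤
      (2 * (n * k) + 1) * Module.finrank F (wordSpan F S n) := by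
    exact_mod_cast X.finrank_box_le (wordSpan F S n) (n * k) _ (hS n)
  have hnp : (0 : ℝ) < n := by linarith
  calc (Module.finrank F (wordSpan F s n) : ℝ)
      ≤ (2 * (n * k) + 1) * Module.finrank F (wordSpan F S n) := h3
    _ ≤ (n * (2 * k + 1)) * Module.finrank F (wordSpan F S n) := by gcongr; nlinarith
    _ ≤ (n * (n : ℝ) ^ ε) * (n : ℝ) ^ (e + ε) := by gcongr
    _ = (n : ℝ) ^ t := by
      rw [← Real.rpow_one_add' hnp.le (by positivity), ← Real.rpow_add hnp]
      congr 1
      rw [hε]; ring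

/-- The sum `V(n) ⊕ V(n) x ⊕ ⋯ ⊕ V(n) xⁿ` consists of words of length at most `2 n`. -/
theorem mul_finrank_wordSpan_le [DecidableEq (AddMonoidAlgebra R M)] (s : Finset R) (n : ℕ) :
    (n + 1) * Module.finrank F (wordSpan F s n) ≤ Module.finrank F
      (wordSpan F (insert (single X.gen 1) (s.image (single 0)) : Finset (AddMonoidAlgebra R M))
        (2 * n)) := by
  classical
  set S : Finset (AddMonoidAlgebra R M) := insert (single X.gen 1) (s.image (single 0)) with hS
  have hmono (i : ℕ) : (single (i • X.gen) 1 : AddMonoidAlgebra R M) ∈ wordSpan F S i := by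
    have : (single (i • X.gen) 1 : AddMonoidAlgebra R M) = single X.gen 1 ^ i := by
      rw [AddMonoidAlgebra.single_pow, one_pow]
    rw [this]
    have h1 := Submodule.pow_mem_pow _
      (subset_wordSpan_one (F := F) (Finset.mem_insert_self (single X.gen 1) _ : _ ∈ S)) i
    rwa [wordSpan, pow_one] at h1
  have hzero (r : R) (hr : r ∈ wordSpan F s n) :
      (single 0 r : AddMonoidAlgebra R M) ∈ wordSpan F S n := by
    have h1 : (wordSpan F s n).map (singleZeroAlgHom (R := F) (M := M)).toLinearMap ≤
        wordSpan F S n := by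
      rw [wordSpan, Submodule.map_pow, Submodule.map_sup, Submodule.map_one, Submodule.map_span]
      refine pow_le_pow_left' (sup_le_sup_left (Submodule.span_mono ?_) 1) n
      rintro _ ⟨r, hr, rfl⟩
      exact Finset.mem_insert_of_mem (Finset.mem_image_of_mem _ hr)
    exact h1 ⟨r, hr, rfl⟩
  let f : (Fin (n + 1) → wordSpan F s n) →ₗ[F] AddMonoidAlgebra R M :=
    ∑ i : Fin (n + 1), lsingle ((i : ℕ) • X.gen) ∘ₗ (wordSpan F s n).subtype ∘ₗ LinearMap.proj i
  have hf_apply (g) : f g = ∑ i : Fin (n + 1), single ((i : ℕ) • X.gen) (g i : R) := by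
    simp [f]
  have hf (g) : f g ∈ wordSpan F S (2 * n) := by
    rw [hf_apply]
    refine Submodule.sum_mem _ fun i _ => ?_
    have e : (single ((i : ℕ) • X.gen) (g i : R) : AddMonoidAlgebra R M) =
        single 0 (g i : R) * single ((i : ℕ) • X.gen) 1 := by
      rw [single_mul_single, zero_add, mul_one]
    rw [e]
    exact wordSpan_mono S (by omega) (mul_mem_wordSpan (hzero _ (g i).2) (hmono i))
  have hgen : Function.Injective fun i : Fin (n + 1) => (i : ℕ) • X.gen := fun i j hij => by
    have := congrArg X.toInt hij
    simp only [map_nsmul, X.toInt_gen] at this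
    ext
    simpa using this
  have hinj : Function.Injective (f.codRestrict (wordSpan F S (2 * n)) hf) := by
    rw [injective_iff_map_eq_zero]
    intro g hg
    have h0 : f g = 0 := congrArg Subtype.val hg
    ext i
    have h1 := congrArg (fun b => b.coeff ((i : ℕ) • X.gen)) h0
    simp only [hf_apply, coeff_sum, coeff_single, Finsupp.finsetSum_apply, coeff_zero,
      Finsupp.zero_apply] at h1
    rw [Finset.sum_eq_single i (fun j _ hj => Finsupp.single_eq_of_ne
      (fun h => hj (hgen h.symm))) (by simp), Finsupp.single_eq_same] at h1
    exact h1
  have := LinearMap.finrank_le_finrank_of_injective hinj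
  rwa [Module.finrank_pi_fintype, Finset.sum_const, Finset.card_univ, Fintype.card_fin,
    smul_eq_mul] at this

theorem GKdim_le_sub_one (X : ExponentMonoid M) {e : ℝ} (h : GKdim F (AddMonoidAlgebra R M) ≤ e) :
    GKdim F R ≤ ((e - 1 : ℝ) : EReal) := by
  classical
  rw [GKdim_le_iff] at h ⊢
  intro s t ht
  set a : ℝ := (e + (t + 1)) / 2 with ha
  have hε0 : 0 < t + 1 - a := by rw [ha]; linarith
  have hlim := (tendsto_rpow_atTop hε0).comp tendsto_natCast_atTop_atTop
  have h2n : Filter.Tendsto (fun n : ℕ => 2 * n) Filter.atTop Filter.atTop :=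
    Filter.tendsto_id.const_mul_atTop' two_pos
  filter_upwards [h2n.eventually (h (insert (single X.gen 1) (s.image (single 0))) a
      (by rw [ha]; linarith)), Filter.eventually_ge_atTop 1,
    hlim.eventually_ge_atTop ((2 : ℝ) ^ a)] with n h1 hn1 h2
  have hn : (1 : ℝ) ≤ n := by exact_mod_cast hn1
  have hnp : (0 : ℝ) < n := by linarith
  have h2' : (2 : ℝ) ^ a ≤ (n : ℝ) ^ (t + 1 - a) := h2
  have h3 : ((n : ℝ) + 1) * Module.finrank F (wordSpan F s n) ≤ ((2 * n : ℕ) : ℝ) ^ a :=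
    le_trans (by exact_mod_cast X.mul_finrank_wordSpan_le (F := F) s n) h1
  have h4 : (n : ℝ) * Module.finrank F (wordSpan F s n) ≤ n * (n : ℝ) ^ t :=
    calc (n : ℝ) * Module.finrank F (wordSpan F s n)
        ≤ ((n : ℝ) + 1) * Module.finrank F (wordSpan F s n) := by gcongr; linarith
      _ ≤ ((2 * n : ℕ) : ℝ) ^ a := h3
      _ = (2 : ℝ) ^ a * (n : ℝ) ^ a := by
        push_cast
        rw [Real.mul_rpow zero_le_two hnp.le]
      _ ≤ (n : ℝ) ^ (t + 1 - a) * (n : ℝ) ^ a := by gcongr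
      _ = n * (n : ℝ) ^ t := by
        rw [← Real.rpow_add hnp, sub_add_cancel, Real.rpow_add hnp, Real.rpow_one, mul_comm]
  exact le_of_mul_le_mul_left h4 hnp

theorem GKdim_addMonoidAlgebra (X : ExponentMonoid M) {N : ℕ} (h : GKdim F R = ((N : ℝ) : EReal)) :
    GKdim F (AddMonoidAlgebra R M) = (((N + 1 : ℕ) : ℝ) : EReal) := by
  push_cast
  refine le_antisymm (X.GKdim_le_add_one h.le) ?_
  by_contra hlt
  obtain ⟨e, he, heN⟩ := EReal.lt_iff_exists_real_btwn.1 (not_le.1 hlt)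
  have h1 := X.GKdim_le_sub_one he.le
  rw [h, EReal.coe_le_coe_iff] at h1
  have h2 : e < N + 1 := by exact_mod_cast heN
  linarith

end ExponentMonoid

/-! ### Iterated extensions -/

theorem AddMonoidAlgebra.finiteType_of_fg_exponents {F : Type v} {A : Type u} {M : Type*} [Field F]
    [Ring A] [Algebra F A] [AddCommMonoid M] (hA : Algebra.FiniteType F A) (hM : AddMonoid.FG M) :
    Algebra.FiniteType F (AddMonoidAlgebra A M) := by
  classical
  obtain ⟨s, hs⟩ := hA.out
  obtain ⟨t, ht⟩ := hM.fg_top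
  refine ⟨⟨(s.image (single 0) ∪ t.image fun m => single m 1 : Finset (AddMonoidAlgebra A M)), ?_⟩⟩
  set T := Algebra.adjoin F ((s.image (single 0) ∪ t.image fun m => single m 1 :
    Finset (AddMonoidAlgebra A M)) : Set (AddMonoidAlgebra A M))
  have h1 (a : A) : (single 0 a : AddMonoidAlgebra A M) ∈ T := by
    have : (⊤ : Subalgebra F A) ≤ T.comap singleZeroAlgHom := by
      rw [← hs, Algebra.adjoin_le_iff]
      exact fun a ha => Algebra.subset_adjoin
        (Finset.mem_union_left _ (Finset.mem_image_of_mem _ ha))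
    exact this Algebra.mem_top
  have h2 (m : M) : (single m 1 : AddMonoidAlgebra A M) ∈ T := by
    have hm : m ∈ AddSubmonoid.closure (t : Set M) := ht ▸ AddSubmonoid.mem_top m
    induction hm using AddSubmonoid.closure_induction with
    | mem m hm =>
      exact Algebra.subset_adjoin (Finset.mem_union_right _ (Finset.mem_image_of_mem _ hm))
    | zero => exact h1 1
    | add m n _ _ hm hn =>
      have := mul_mem hm hn
      rwa [single_mul_single, one_mul] at this
  rw [eq_top_iff]
  intro x _
  induction x using AddMonoidAlgebra.induction_linear with
  | zero => exact zero_mem _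
  | add x y hx hy => exact add_mem (hx Algebra.mem_top) (hy Algebra.mem_top)
  | single m a =>
    have := mul_mem (h1 a) (h2 m)
    rwa [single_mul_single, zero_add, mul_one] at this

/-- The step of the induction: one central variable, possibly invertible, is adjoined. -/
theorem HasFiniteSmoothCalculus.addMonoidAlgebra {F : Type v} {R : Type u} [Field F] [Ring R]
    [Algebra F R] {M : Type} [AddCommMonoid M] (hF : ∃ q : Fˣ, ¬ IsOfFinOrder q)
    (X : ExponentMonoid M) (hM : AddMonoid.FG M) (h : HasFiniteSmoothCalculus F R) :
    HasFiniteSmoothCalculus F (AddMonoidAlgebra R M) := by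
  obtain ⟨q, hq⟩ := hF
  have hq1 : q ≠ 1 := fun h => hq (h ▸ IsOfFinOrder.one)
  obtain ⟨Ω, _, _, c, ⟨hft, N, hGK, hconn, hdim, hint⟩, hfin⟩ := h
  exact ⟨_, _, _, c.polyExt X hq1,
    ⟨AddMonoidAlgebra.finiteType_of_fg_exponents hft hM, N + 1, X.GKdim_addMonoidAlgebra hGK,
      c.isConnected_polyExt hconn hq hq1, c.hasDimension_polyExt hdim hq1,
      c.isIntegrable_polyExt hfin hdim hint hq1⟩, c.finite_forms_polyExt hfin hq1⟩

/-- A function on `Fin (n + 1)` amounts to its value at `0` and its tail. -/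
noncomputable def finsuppFinSuccAddEquiv (n : ℕ) (M : Type*) [AddCommMonoid M] :
    M × (Fin n →₀ M) ≃+ (Fin (n + 1) →₀ M) where
  toFun p := Finsupp.cons p.1 p.2
  invFun f := (f 0, Finsupp.tail f)
  left_inv p := by simp
  right_inv f := by simp
  map_add' p p' := by
    ext i
    refine Fin.cases ?_ (fun i => ?_) i <;> simp

theorem HasFiniteSmoothCalculus.polynomialLaurent {F : Type v} {R : Type u} [Field F] [Ring R]
    [Algebra F R] (hF : ∃ q : Fˣ, ¬ IsOfFinOrder q) (h : HasFiniteSmoothCalculus F R) (n m : ℕ) :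
    HasFiniteSmoothCalculus F (PolynomialLaurent R n m) := by
  induction n with
  | zero =>
    induction m with
    | zero => exact h.of_algEquiv (AddMonoidAlgebra.uniqueAlgEquiv F _).symm
    | succ m ih =>
      refine (ih.addMonoidAlgebra hF .int inferInstance).of_algEquiv
        ((AddMonoidAlgebra.curryAlgEquiv F).symm.trans (AddMonoidAlgebra.domCongr F R ?_))
      exact (AddEquiv.prodAssoc.symm.trans
        ((AddEquiv.prodComm).prodCongr (.refl _))).trans (AddEquiv.prodAssoc.trans
          ((AddEquiv.refl _).prodCongr (finsuppFinSuccAddEquiv m ℤ)))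
  | succ n ih =>
    refine (ih.addMonoidAlgebra hF .nat inferInstance).of_algEquiv
      ((AddMonoidAlgebra.curryAlgEquiv F).symm.trans (AddMonoidAlgebra.domCongr F R ?_))
    exact AddEquiv.prodAssoc.symm.trans
      ((finsuppFinSuccAddEquiv n ℕ).prodCongr (AddEquiv.refl _))

theorem mainTheorem4 {F : Type v} {R : Type u} {Ω : Type u} [Field F] [Ring R] [Algebra F R]
    [Ring Ω] [Algebra F Ω] (hF : ∃ q : Fˣ, ¬ IsOfFinOrder q)
    (c : DifferentialCalculus F R Ω) (hc : c.IsSmooth)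
    (hfin : Module.Finite Rᵐᵒᵖ c.Forms) (hproj : Module.Projective Rᵐᵒᵖ c.Forms) (n m : ℕ) :
    DifferentiallySmooth F (PolynomialLaurent R n m) := by
  obtain ⟨Ω', _, _, c', hc', -⟩ :=
    HasFiniteSmoothCalculus.polynomialLaurent hF ⟨Ω, _, _, c, hc, hfin⟩ n m
  exact ⟨Ω', _, _, c', hc'⟩
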